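/- Let $X$ be a connected, paracompact, Hausdorff (finite-dimensional) complex manifold, let $\mathrm{O}(X)$ be its ring of holomorphic functions, let $W\in\mathrm{O}(X)$, and let $Z_W=\{p\in X : (\partial W)(p)=0\}$ be its critical set. (In particular this applies to every Landau–Ginzburg pair $(X,W)$, where moreover $X$ is non-compact, Kählerian and of positive dimension with holomorphically trivial canonical bundle and $W$ is non-constant.) A holomorphic factorization of $W$ is a pair $a=(E,D)$, where $E=E^{\hat 0}\oplus E^{\hat 1}$ is a holomorphic vector superbundle of finite rank on $X$ and $D$ is an odd holomorphic section of $End(E)$ with $D^2=W\,\mathrm{id}_E$. The twisted Dolbeault category of holomorphic factorizations $\mathrm{DF}(X,W)$ is the $\mathbb{Z}_2$-graded $\mathrm{O}(X)$-linear dg-category whose objects are the holomorphic factorizations of $W$ and whose morphisms from $a_1=(E_1,D_1)$ to $a_2=(E_2,D_2)$ are the smooth sections of $\wedge \overline{T}^\ast X\otimes Hom(E_1,E_2)$ (where $\wedge\overline{T}^\ast X$ is the bundle of forms of type $(0,\ast)$), graded by $\mathrm{rk}\,\rho+\sigma(f) \bmod 2$ on $\rho\otimes f$, where $\mathrm{rk}$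 is the form rank and $\sigma$ the bundle parity; the composition is determined by $(\rho\otimes f)\circ(\eta\otimes g)=(-1)^{\sigma(f)\,\mathrm{rk}\,\eta}(\rho\wedge\eta)\otimes(f\circ g)$, and the differential is $\delta_{a_1,a_2}=\overline{\partial}_{Hom(E_1,E_2)}+\mathfrak{d}_{a_1,a_2}$, where $\mathfrak{d}_{a_1,a_2}(\rho\otimes f)=(-1)^{\mathrm{rk}\rho}\rho\otimes(D_2\circ f)-(-1)^{\mathrm{rk}\rho+\sigma(f)}\rho\otimes(f\circ D_1)$. The (in general non-unital) subcategory $\mathrm{DF}_c(X,W)$ has the same objects, and its morphisms are the morphisms of $\mathrm{DF}(X,W)$ that have compact support. Let $j:\mathrm{DF}_c(X,W)\to\mathrm{DF}(X,W)$ be the inclusion functor. **Proposition.** If $Z_W$ is compact, then $j$ is a quasi-equivalence: for all holomorphic factorizations $a_1,a_2$ of $W$ the map induced by $j$ on the cohomology of $\mathrm{Hom}(a_1,a_2)$ is bijective, and every object of $\mathrm{DF}(X,W)$ is isomorphic, in the degree zero cohomology category of $\mathrm{DF}(X,W)$, to an object in the image of $j$. Moreover, for all $a_1,a_2$ the inclusion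 $j_{a_1,a_2}:\mathrm{Hom}_{\mathrm{DF}_c(X,W)}(a_1,a_2)\to\mathrm{Hom}_{\mathrm{DF}(X,W)}(a_1,a_2)$ is a homotopy equivalence: there are $\mathrm{O}(X)$-linear maps $\pi:\mathrm{Hom}_{\mathrm{DF}(X,W)}(a_1,a_2)\to\mathrm{Hom}_{\mathrm{DF}_c(X,W)}(a_1,a_2)$, which is even and satisfies $\pi\circ\delta=\delta_c\circ\pi$, and $\mathcal{R}:\mathrm{Hom}_{\mathrm{DF}(X,W)}(a_1,a_2)\to\mathrm{Hom}_{\mathrm{DF}(X,W)}(a_1,a_2)$, which is odd and preserves compactness of supports, such that $$\mathrm{id}-j_{a_1,a_2}\circ\pi=\delta\circ\mathcal{R}+\mathcal{R}\circ\delta,\qquad \mathrm{id}-\pi\circ j_{a_1,a_2}=\delta_c\circ\mathcal{R}_c+\mathcal{R}_c\circ\delta_c ,$$ where $\delta=\delta_{a_1,a_2}$ and where $\delta_c$, $\mathcal{R}_c$ are the restrictions of $\delta$, $\mathcal{R}$ to the forms with compact support. -/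

import Mathlib

open scoped Manifold ContDiff Topology TensorProduct ComplexConjugate
open Bundle Set Filter

set_option linter.unusedSectionVars false

noncomputable section
namespace LG

section Fiber

variable {T : Type*} [AddCommGroup T] [Module ℂ T] [TopologicalSpace T]
  {T' : Type*} [AddCommGroup T'] [Module ℂ T'] [TopologicalSpace T']
  {T'' : Type*} [AddCommGroup T''] [Module ℂ T''] [TopologicalSpace T'']
  {E : Type*} [AddCommGroup E] [Module ℂ E] [TopologicalSpace E] [IsTopologicalAddGroup E]
  [ContinuousSMul ℂ E]
  {G : Type*} [AddCommGroup G] [Module ℂ G] [TopologicalSpace G] [IsTopologicalAddGroup G]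
  [ContinuousSMul ℂ G]
  {K : Type*} [AddCommGroup K] [Module ℂ K] [TopologicalSpace K] [IsTopologicalAddGroup K]
  [ContinuousSMul ℂ K]
  {K' : Type*} [AddCommGroup K'] [Module ℂ K'] [TopologicalSpace K'] [IsTopologicalAddGroup K']
  [ContinuousSMul ℂ K']
  {L' : Type*} [AddCommGroup L'] [Module ℂ L'] [TopologicalSpace L'] [IsTopologicalAddGroup L']
  [ContinuousSMul ℂ L']
  {L : Type*} [AddCommGroup L] [Module ℂ L] [TopologicalSpace L] [IsTopologicalAddGroup L]
  [ContinuousSMul ℂ L]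

variable (T) in
/-- The exterior algebra `∧ T̄*` of the space `T̄*` of conjugate-linear functionals on `T`. -/
abbrev AntiExt : Type _ := ExteriorAlgebra ℂ (T →L⋆[ℂ] ℂ)

variable (T E G) in
/-- The space `∧ T̄* ⊗ Hom(E, G)`. -/
def FormFiber : Type _ := AntiExt T ⊗[ℂ] (E →L[ℂ] G)

instance : AddCommGroup (FormFiber T E G) :=
  inferInstanceAs (AddCommGroup (AntiExt T ⊗[ℂ] (E →L[ℂ] G)))

instance : Module ℂ (FormFiber T E G) :=
  inferInstanceAs (Module ℂ (AntiExt T ⊗[ℂ] (E →L[ℂ] G)))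

namespace FormFiber

/-- The pure tensor `ρ ⊗ f`. -/
def tmul (ρ : AntiExt T) (f : E →L[ℂ] G) : FormFiber T E G := ρ ⊗ₜ[ℂ] f

/-- Composition of linear maps as a bilinear map. -/
def compBilin : (G →L[ℂ] K) →ₗ[ℂ] (E →L[ℂ] G) →ₗ[ℂ] (E →L[ℂ] K) :=
  LinearMap.mk₂ ℂ (fun f g => f.comp g)
    (fun _ _ _ => ContinuousLinearMap.add_comp _ _ _) (fun _ _ _ => ContinuousLinearMap.smul_comp _ _ _)
    (fun _ _ _ => ContinuousLinearMap.comp_add _ _ _) (fun _ _ _ => ContinuousLinearMap.comp_smul _ _ _)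

/-- The product `(ρ ⊗ f) * (η ⊗ g) = (ρ ∧ η) ⊗ (f ∘ g)`, without signs. -/
def mul : FormFiber T G K →ₗ[ℂ] FormFiber T E G →ₗ[ℂ] FormFiber T E K :=
  TensorProduct.map₂ (LinearMap.mul ℂ (AntiExt T)) compBilin

/-- The sign operator of the rank grading: `ρ ⊗ f ↦ (-1) ^ rk ρ • ρ ⊗ f`. -/
def rankSign : FormFiber T E G →ₗ[ℂ] FormFiber T E G :=
  TensorProduct.map (CliffordAlgebra.involute (Q := (0 : QuadraticForm ℂ (T →L⋆[ℂ] ℂ)))).toLinearMap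
    LinearMap.id

/-- A linear map, regarded as a form of rank zero: `f ↦ 1 ⊗ f`. -/
def ofHom : (E →L[ℂ] G) →ₗ[ℂ] FormFiber T E G := TensorProduct.mk ℂ _ _ 1

/-- Exterior multiplication by a covector on the left: `u ∧ (ρ ⊗ f) = (u ∧ ρ) ⊗ f`. -/
def wedge : (T →L⋆[ℂ] ℂ) →ₗ[ℂ] FormFiber T E G →ₗ[ℂ] FormFiber T E G :=
  ((TensorProduct.mapBilinear (.id ℂ) (AntiExt T) (E →L[ℂ] G) (AntiExt T) (E →L[ℂ] G)).flip
    LinearMap.id) ∘ₗ LinearMap.mul ℂ (AntiExt T) ∘ₗ ExteriorAlgebra.ι ℂ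

/-- Pullback of conjugate-linear functionals along a linear map. -/
def pullCovector (A : T' →L[ℂ] T) : (T →L⋆[ℂ] ℂ) →ₗ[ℂ] (T' →L⋆[ℂ] ℂ) where
  toFun u := u.comp A
  map_add' _ _ := rfl
  map_smul' _ _ := rfl

/-- The map `∧ T̄* ⊗ Hom(E, G) → ∧ T̄'* ⊗ Hom(L, K)` induced by linear maps `A : T' → T`,
`a : L → E` and `b : G → K`. -/
def map (A : T' →L[ℂ] T) (a : L →L[ℂ] E) (b : G →L[ℂ] K) :
    FormFiber T E G →ₗ[ℂ] FormFiber T' L K :=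
  TensorProduct.map (ExteriorAlgebra.map (pullCovector A)).toLinearMap
    (compBilin b ∘ₗ compBilin.flip a)

@[elab_as_elim]
theorem induction {P : FormFiber T E G → Prop} (x : FormFiber T E G) (h0 : P 0)
    (ht : ∀ ρ f, P (tmul ρ f)) (ha : ∀ x y, P x → P y → P (x + y)) : P x :=
  TensorProduct.induction_on x h0 ht ha

theorem hom_ext {N : Type*} [AddCommGroup N] [Module ℂ N] {φ ψ : FormFiber T E G →ₗ[ℂ] N}
    (h : ∀ ρ f, φ (tmul ρ f) = ψ (tmul ρ f)) : φ = ψ :=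
  TensorProduct.ext' h

@[simp] theorem mul_tmul (ρ η : AntiExt T) (f : G →L[ℂ] K) (g : E →L[ℂ] G) :
    mul (tmul ρ f) (tmul η g) = tmul (ρ * η) (f.comp g) := rfl

@[simp] theorem rankSign_tmul (ρ : AntiExt T) (f : E →L[ℂ] G) :
    rankSign (tmul ρ f) = tmul (CliffordAlgebra.involute ρ) f := rfl

@[simp] theorem wedge_tmul (u : T →L⋆[ℂ] ℂ) (ρ : AntiExt T) (f : E →L[ℂ] G) :
    wedge u (tmul ρ f) = tmul (ExteriorAlgebra.ι ℂ u * ρ) f := rfl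

@[simp] theorem map_tmul (A : T' →L[ℂ] T) (a : L →L[ℂ] E) (b : G →L[ℂ] K) (ρ : AntiExt T)
    (f : E →L[ℂ] G) :
    map A a b (tmul ρ f) =
      tmul (ExteriorAlgebra.map (pullCovector A) ρ) (b.comp (f.comp a)) := rfl

theorem ofHom_eq (f : E →L[ℂ] G) : (ofHom f : FormFiber T E G) = tmul 1 f := rfl

theorem mul_assoc (x : FormFiber T K L) (y : FormFiber T G K) (z : FormFiber T E G) :
    mul (mul x y) z = mul x (mul y z) := by
  induction x using induction with
  | h0 => simp
  | ha x x' h h' => simp [h, h']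
  | ht ρ f =>
    induction y using induction with
    | h0 => simp
    | ha x x' h h' => simp [h, h']
    | ht η g =>
      induction z using induction with
      | h0 => simp
      | ha x x' h h' => simp only [map_add, h, h']
      | ht ζ k => simp [_root_.mul_assoc, ContinuousLinearMap.comp_assoc]

theorem rankSign_mul (x : FormFiber T G K) (y : FormFiber T E G) :
    rankSign (mul x y) = mul (rankSign x) (rankSign y) := by
  induction x using induction with
  | h0 => simp
  | ha x x' h h' => simp [h, h']
  | ht ρ f =>
    induction y using induction with
    | h0 => simp
    | ha x x' h h' => simp [h, h']
    | ht η g => simp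

@[simp] theorem rankSign_rankSign (x : FormFiber T E G) : rankSign (rankSign x) = x := by
  induction x using induction with
  | h0 => simp
  | ha x x' h h' => simp [h, h']
  | ht ρ f => simp

@[simp] theorem rankSign_ofHom (f : E →L[ℂ] G) :
    rankSign (ofHom f : FormFiber T E G) = ofHom f := by
  simp [ofHom_eq]

@[simp] theorem ofHom_mul_ofHom (f : G →L[ℂ] K) (g : E →L[ℂ] G) :
    mul (ofHom f : FormFiber T G K) (ofHom g) = ofHom (f.comp g) := by
  simp [ofHom_eq]

@[simp] theorem one_mul (x : FormFiber T E G) : mul (ofHom (.id ℂ G)) x = x := by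
  induction x using induction with
  | h0 => simp
  | ha x x' h h' => simp [h, h']
  | ht ρ f => simp [ofHom_eq]

@[simp] theorem mul_one (x : FormFiber T E G) : mul x (ofHom (.id ℂ E)) = x := by
  induction x using induction with
  | h0 => simp
  | ha x x' h h' => simp [h, h']
  | ht ρ f => simp [ofHom_eq]

theorem wedge_mul (u : T →L⋆[ℂ] ℂ) (x : FormFiber T G K) (y : FormFiber T E G) :
    mul (wedge u x) y = wedge u (mul x y) := by
  induction x using induction with
  | h0 => simp
  | ha x x' h h' => simp [h, h']
  | ht ρ f =>
    induction y using induction with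
    | h0 => simp
    | ha x x' h h' => simp only [map_add, h, h']
    | ht η g => simp [_root_.mul_assoc]

theorem mul_ι_eq (ρ : AntiExt T) (u : T →L⋆[ℂ] ℂ) :
    ρ * ExteriorAlgebra.ι ℂ u = ExteriorAlgebra.ι ℂ u * CliffordAlgebra.involute ρ := by
  induction ρ using ExteriorAlgebra.induction with
  | algebraMap r => simp [Algebra.commutes]
  | ι v =>
    have h : (ExteriorAlgebra.ι ℂ v * ExteriorAlgebra.ι ℂ u + ExteriorAlgebra.ι ℂ u *
      ExteriorAlgebra.ι ℂ v : AntiExt T) = 0 := ExteriorAlgebra.ι_add_mul_swap v u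
    have h2 : CliffordAlgebra.involute (Q := (0 : QuadraticForm ℂ (T →L⋆[ℂ] ℂ)))
      (ExteriorAlgebra.ι ℂ v) = -ExteriorAlgebra.ι ℂ v := CliffordAlgebra.involute_ι v
    rw [h2, mul_neg]
    exact eq_neg_of_add_eq_zero_left h
  | mul a b ha hb => rw [_root_.mul_assoc, hb, ← _root_.mul_assoc, ha, map_mul, _root_.mul_assoc]
  | add a b ha hb => rw [add_mul, ha, hb, map_add, mul_add]

theorem mul_wedge (u : T →L⋆[ℂ] ℂ) (x : FormFiber T G K) (y : FormFiber T E G) :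
    mul x (wedge u y) = wedge u (mul (rankSign x) y) := by
  induction x using induction with
  | h0 => simp
  | ha x x' h h' => simp [h, h']
  | ht ρ f =>
    induction y using induction with
    | h0 => simp
    | ha x x' h h' => simp [h, h']
    | ht η g => simp [← _root_.mul_assoc, mul_ι_eq]

theorem rankSign_wedge (u : T →L⋆[ℂ] ℂ) (x : FormFiber T E G) :
    rankSign (wedge u x) = -wedge u (rankSign x) := by
  induction x using induction with
  | h0 => simp
  | ha x x' h h' => simp [h, h']; abel
  | ht ρ f =>
    have h2 : CliffordAlgebra.involute (Q := (0 : QuadraticForm ℂ (T →L⋆[ℂ] ℂ)))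
      (ExteriorAlgebra.ι ℂ u) = -ExteriorAlgebra.ι ℂ u := CliffordAlgebra.involute_ι u
    rw [wedge_tmul, rankSign_tmul, rankSign_tmul, wedge_tmul, map_mul, h2, neg_mul]
    exact TensorProduct.neg_tmul _ _

theorem wedge_wedge (u v : T →L⋆[ℂ] ℂ) (x : FormFiber T E G) :
    wedge u (wedge v x) = -wedge v (wedge u x) := by
  induction x using induction with
  | h0 => simp
  | ha x x' h h' => simp [h, h']; abel
  | ht ρ f =>
    have h : (ExteriorAlgebra.ι ℂ u * ExteriorAlgebra.ι ℂ v : AntiExt T) =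
      -(ExteriorAlgebra.ι ℂ v * ExteriorAlgebra.ι ℂ u) :=
        eq_neg_of_add_eq_zero_left (ExteriorAlgebra.ι_add_mul_swap u v)
    rw [wedge_tmul, wedge_tmul, wedge_tmul, wedge_tmul, ← _root_.mul_assoc, h, neg_mul,
      _root_.mul_assoc]
    exact TensorProduct.neg_tmul _ _

theorem map_wedge (A : T' →L[ℂ] T) (a : L →L[ℂ] E) (b : G →L[ℂ] K) (u : T →L⋆[ℂ] ℂ)
    (x : FormFiber T E G) : map A a b (wedge u x) = wedge (u.comp A) (map A a b x) := by
  induction x using induction with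
  | h0 => simp
  | ha x x' h h' => simp [h, h']
  | ht ρ f =>
    rw [wedge_tmul, map_tmul, map_tmul, wedge_tmul, _root_.map_mul, ExteriorAlgebra.map_apply_ι]
    rfl

theorem map_rankSign (A : T' →L[ℂ] T) (a : L →L[ℂ] E) (b : G →L[ℂ] K)
    (x : FormFiber T E G) : map A a b (rankSign x) = rankSign (map A a b x) := by
  induction x using induction with
  | h0 => simp
  | ha x x' h h' => simp only [map_add, h, h']
  | ht ρ f =>
    have h : ∀ ρ : AntiExt T, ExteriorAlgebra.map (pullCovector A) (CliffordAlgebra.involute ρ) =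
        CliffordAlgebra.involute (ExteriorAlgebra.map (pullCovector A) ρ) := by
      intro ρ
      induction ρ using ExteriorAlgebra.induction with
      | algebraMap r => simp
      | ι v =>
        have h1 : CliffordAlgebra.involute (Q := (0 : QuadraticForm ℂ (T →L⋆[ℂ] ℂ)))
          (ExteriorAlgebra.ι ℂ v) = -ExteriorAlgebra.ι ℂ v := CliffordAlgebra.involute_ι v
        have h2 : ∀ w, CliffordAlgebra.involute (Q := (0 : QuadraticForm ℂ (T' →L⋆[ℂ] ℂ)))
          (ExteriorAlgebra.ι ℂ w) = -ExteriorAlgebra.ι ℂ w := fun w => CliffordAlgebra.involute_ι w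
        rw [h1, map_neg, ExteriorAlgebra.map_apply_ι, h2]
      | mul a b ha hb => simp only [_root_.map_mul, ha, hb]
      | add a b ha hb => simp only [map_add, ha, hb]
    rw [rankSign_tmul, map_tmul, map_tmul, rankSign_tmul, h]

theorem map_ofHom (A : T' →L[ℂ] T) (a : L →L[ℂ] E) (b : G →L[ℂ] K) (f : E →L[ℂ] G) :
    map A a b (ofHom f) = ofHom (b.comp (f.comp a)) := by
  rw [ofHom_eq, map_tmul, map_one, ofHom_eq]

theorem map_mul (A : T' →L[ℂ] T) (a : L →L[ℂ] E) (b : K →L[ℂ] K') (c : L' →L[ℂ] G)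
    (c' : G →L[ℂ] L') (hc : c.comp c' = .id ℂ G) (x : FormFiber T G K) (y : FormFiber T E G) :
    map A a b (mul x y) = mul (map A c b x) (map A a c' y) := by
  induction x using induction with
  | h0 => simp
  | ha x x' h h' => simp only [map_add, LinearMap.add_apply, h, h']
  | ht ρ f =>
    induction y using induction with
    | h0 => simp
    | ha x x' h h' => simp only [map_add, h, h']
    | ht η g =>
      have h : (b.comp (f.comp c)).comp (c'.comp (g.comp a)) = b.comp ((f.comp g).comp a) := by
        ext v
        have h := congrArg (fun φ : G →L[ℂ] G => φ (g (a v))) hc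
        simp only [ContinuousLinearMap.comp_apply, ContinuousLinearMap.id_apply] at h
        simp only [ContinuousLinearMap.comp_apply, h]
      rw [mul_tmul, map_tmul, map_tmul, map_tmul, mul_tmul, _root_.map_mul, h]

theorem map_map (A : T' →L[ℂ] T) (a : L →L[ℂ] E) (b : G →L[ℂ] K) (A' : T'' →L[ℂ] T')
    (a' : L' →L[ℂ] L) (b' : K →L[ℂ] K') (x : FormFiber T E G) :
    map A' a' b' (map A a b x) = map (A.comp A') (a.comp a') (b'.comp b) x := by
  induction x using induction with
  | h0 => simp
  | ha x x' h h' => simp only [map_add, h, h']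
  | ht ρ f =>
    have h : (ExteriorAlgebra.map (pullCovector A')).comp (ExteriorAlgebra.map (pullCovector A)) =
        ExteriorAlgebra.map (pullCovector (A.comp A')) := ExteriorAlgebra.map_comp_map _ _
    rw [map_tmul, map_tmul, map_tmul, ← h]
    rfl

theorem map_id (x : FormFiber T E G) : map (.id ℂ T) (.id ℂ E) (.id ℂ G) x = x := by
  induction x using induction with
  | h0 => simp
  | ha x x' h h' => simp only [map_add, h, h']
  | ht ρ f =>
    have h : ExteriorAlgebra.map (pullCovector (.id ℂ T)) = AlgHom.id ℂ (AntiExt T) :=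
      ExteriorAlgebra.map_id
    rw [map_tmul, h]
    rfl

end FormFiber
end Fiber
end LG

namespace LG

section Model

variable {V : Type*} [NormedAddCommGroup V] [NormedSpace ℂ V] [FiniteDimensional ℂ V]
  {F : Type*} [NormedAddCommGroup F] [NormedSpace ℂ F] [FiniteDimensional ℂ F]
  {G : Type*} [NormedAddCommGroup G] [NormedSpace ℂ G] [FiniteDimensional ℂ G]
  {H : Type*} [NormedAddCommGroup H] [NormedSpace ℂ H] [FiniteDimensional ℂ H]
  {H' : Type*} [NormedAddCommGroup H'] [NormedSpace ℂ H'] [FiniteDimensional ℂ H']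
  {S : Type*} [NormedAddCommGroup S] [NormedSpace ℂ S]
  {S' : Type*} [NormedAddCommGroup S'] [NormedSpace ℂ S']
  {S'' : Type*} [NormedAddCommGroup S''] [NormedSpace ℂ S'']

instance : FiniteDimensional ℂ (V →L⋆[ℂ] ℂ) := by
  let b := Module.finBasis ℂ V
  let φ : (V →L⋆[ℂ] ℂ) →ₗ[ℂ] (Fin (Module.finrank ℂ V) → ℂ) :=
    { toFun := fun u i => u (b i), map_add' := fun _ _ => rfl, map_smul' := fun _ _ => rfl }
  refine Module.Finite.of_injective φ fun u v h => ?_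
  ext x
  have hx : ∀ w : V →L⋆[ℂ] ℂ, w x = ∑ i, conj (b.repr x i) * w (b i) := by
    intro w
    conv_lhs => rw [← b.sum_repr x]
    rw [map_sum]
    exact Finset.sum_congr rfl fun i _ => w.map_smulₛₗ _ _
  rw [hx u, hx v]
  exact Finset.sum_congr rfl fun i _ => by rw [show u (b i) = v (b i) from congrFun h i]

instance : FiniteDimensional ℂ (FormFiber V F G) := by
  have : FiniteDimensional ℂ (AntiExt V) :=
    Module.Finite.of_basis (Module.finBasis ℂ (V →L⋆[ℂ] ℂ)).ExteriorAlgebra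
  exact inferInstanceAs (FiniteDimensional ℂ (AntiExt V ⊗[ℂ] (F →L[ℂ] G)))

/-- A norm on the finite-dimensional space `∧ V̄* ⊗ Hom(F, G)`, taken from a basis. Only the
(unique) topology and differentiable structure it induces matter. -/
instance : NormedAddCommGroup (FormFiber V F G) :=
  NormedAddCommGroup.induced (FormFiber V F G)
    (Fin (Module.finrank ℂ (FormFiber V F G)) → ℂ)
    (Module.finBasis ℂ (FormFiber V F G)).equivFun.toLinearMap
    (Module.finBasis ℂ (FormFiber V F G)).equivFun.injective

instance : NormedSpace ℂ (FormFiber V F G) :=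
  NormedSpace.induced ℂ (FormFiber V F G)
    (Fin (Module.finrank ℂ (FormFiber V F G)) → ℂ)
    (Module.finBasis ℂ (FormFiber V F G)).equivFun.toLinearMap

variable (V) in
/-- The conjugate coordinate function `z̄ⁱ` of a fixed complex basis of `V`. -/
def conjCoord (i : Fin (Module.finrank ℂ V)) : V →L⋆[ℂ] ℂ :=
  (starL ℂ : ℂ ≃L⋆[ℂ] ℂ).toContinuousLinearMap.comp
    (LinearMap.toContinuousLinearMap ((Module.finBasis ℂ V).coord i))

/-- The conjugate-linear part of the real derivative of `f` at `z`, in the direction `v`: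
`(∂_v f + i ∂_{iv} f) / 2`. For `v = ∂/∂zⁱ` this is the Wirtinger derivative `∂f/∂z̄ⁱ`. -/
def antiDeriv (f : V → S) (z v : V) : S :=
  (2⁻¹ : ℂ) • (fderiv ℝ f z v + Complex.I • fderiv ℝ f z (Complex.I • v))

/-- The Dolbeault operator `∂̄ f = ∑ᵢ dz̄ⁱ ∧ ∂f/∂z̄ⁱ` on `∧ V̄* ⊗ Hom(F, G)`-valued functions
on `V`. -/
def dbarModel (f : V → FormFiber V F G) (z : V) : FormFiber V F G :=
  ∑ i, FormFiber.wedge (conjCoord V i) (antiDeriv f z (Module.finBasis ℂ V i))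

theorem conjCoord_apply (i : Fin (Module.finrank ℂ V)) (v : V) :
    conjCoord V i v = conj ((Module.finBasis ℂ V).repr v i) := rfl

/-- a complex bilinear map, as a continuous real bilinear map -/
def realBilin [FiniteDimensional ℂ S] [FiniteDimensional ℂ S'] (B : S →ₗ[ℂ] S' →ₗ[ℂ] S'') :
    S →L[ℝ] S' →L[ℝ] S'' :=
  (LinearMap.mk₂ ℝ (fun x y => B x y) (fun _ _ _ => by simp)
    (fun c x y => by
      rw [← Complex.coe_smul, map_smul, LinearMap.smul_apply, Complex.coe_smul])
    (fun _ _ _ => by simp)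
    (fun c x y => by
      rw [← Complex.coe_smul, map_smul, Complex.coe_smul])).toContinuousBilinearMap

theorem realBilin_apply [FiniteDimensional ℂ S] [FiniteDimensional ℂ S']
    (B : S →ₗ[ℂ] S' →ₗ[ℂ] S'') (x : S) (y : S') : realBilin B x y = B x y := rfl

/-- a complex linear map, as a continuous real linear map -/
def realLin [FiniteDimensional ℂ S] (B : S →ₗ[ℂ] S') : S →L[ℝ] S' :=
  LinearMap.toContinuousLinearMap (B.restrictScalars ℝ)

theorem realLin_apply [FiniteDimensional ℂ S] (B : S →ₗ[ℂ] S') (x : S) : realLin B x = B x := rfl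

theorem antiDeriv_congr {f g : V → S} {z : V} (h : f =ᶠ[𝓝 z] g) : antiDeriv f z = antiDeriv g z := by
  funext v
  rw [antiDeriv, antiDeriv, h.fderiv_eq]

theorem antiDeriv_add {f g : V → S} {z : V} (hf : DifferentiableAt ℝ f z)
    (hg : DifferentiableAt ℝ g z) (v : V) :
    antiDeriv (fun z => f z + g z) z v = antiDeriv f z v + antiDeriv g z v := by
  simp only [antiDeriv, fderiv_fun_add hf hg, _root_.add_apply, smul_add]
  abel

theorem antiDeriv_lin [FiniteDimensional ℂ S] {f : V → S} {z : V} (hf : DifferentiableAt ℝ f z)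
    (B : S →ₗ[ℂ] S') (v : V) : antiDeriv (fun z => B (f z)) z v = B (antiDeriv f z v) := by
  have h : fderiv ℝ (fun z => B (f z)) z = (realLin B).comp (fderiv ℝ f z) :=
    ((realLin B).hasFDerivAt.comp z hf.hasFDerivAt).fderiv
  simp only [antiDeriv, h, ContinuousLinearMap.comp_apply, realLin_apply, map_smul, map_add]

theorem antiDeriv_bilin [FiniteDimensional ℂ S] [FiniteDimensional ℂ S'] {f : V → S} {g : V → S'}
    {z : V} (hf : DifferentiableAt ℝ f z) (hg : DifferentiableAt ℝ g z)
    (B : S →ₗ[ℂ] S' →ₗ[ℂ] S'') (v : V) :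
    antiDeriv (fun z => B (f z) (g z)) z v =
      B (antiDeriv f z v) (g z) + B (f z) (antiDeriv g z v) := by
  have h : ∀ v, fderiv ℝ (fun z => B (f z) (g z)) z v =
      B (f z) (fderiv ℝ g z v) + B (fderiv ℝ f z v) (g z) := fun v => by
    have h : fderiv ℝ (fun z => B (f z) (g z)) z = _ :=
      ((realBilin B).hasFDerivAt_of_bilinear hf.hasFDerivAt hg.hasFDerivAt).fderiv
    rw [h]
    rfl
  simp only [antiDeriv, h, map_smul, map_add, smul_add, LinearMap.smul_apply, LinearMap.add_apply]
  abel

theorem antiDeriv_eq_zero {f : V → S} {z : V} (hf : DifferentiableAt ℂ f z) (v : V) :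
    antiDeriv f z v = 0 := by
  have h : fderiv ℝ f z = (fderiv ℂ f z).restrictScalars ℝ := hf.fderiv_restrictScalars ℝ
  simp [antiDeriv, h, smul_smul]

theorem antiDeriv_smul_right (f : V → S) (z : V) (c : ℂ) (v : V) :
    antiDeriv f z (c • v) = conj c • antiDeriv f z v := by
  have h : ∀ r : ℝ, ∀ w, fderiv ℝ f z ((r : ℂ) • w) = (r : ℂ) • fderiv ℝ f z w := fun r w => by
    rw [Complex.coe_smul, map_smul, Complex.coe_smul]
  have hc : ∀ w : V, c • w = (c.re : ℂ) • w + (c.im : ℂ) • Complex.I • w := fun w => by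
    rw [smul_smul, ← add_smul, Complex.re_add_im]
  have hI : (Complex.I • Complex.I • v : V) = ((-1 : ℝ) : ℂ) • v := by
    rw [smul_smul, Complex.I_mul_I]; simp
  have hcomm : (Complex.I • c • v : V) = c • Complex.I • v := smul_comm _ _ _
  simp only [antiDeriv, hcomm]
  rw [hc v, hc (Complex.I • v), map_add, map_add, h, h, h, h, hI, h]
  have hconj : conj c = (c.re : ℂ) - c.im * Complex.I := by
    apply Complex.ext <;> simp
  rw [hconj]
  have hII := Complex.I_mul_I
  match_scalars
  · ring
  · linear_combination (c.im / 2 : ℂ) * hII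

end Model
end LG

namespace LG

section Dbar

variable {V : Type*} [NormedAddCommGroup V] [NormedSpace ℂ V] [FiniteDimensional ℂ V]
  {F : Type*} [NormedAddCommGroup F] [NormedSpace ℂ F] [FiniteDimensional ℂ F]
  {G : Type*} [NormedAddCommGroup G] [NormedSpace ℂ G] [FiniteDimensional ℂ G]
  {H : Type*} [NormedAddCommGroup H] [NormedSpace ℂ H] [FiniteDimensional ℂ H]
  {H' : Type*} [NormedAddCommGroup H'] [NormedSpace ℂ H'] [FiniteDimensional ℂ H']

open FormFiber

theorem dbarModel_congr {f g : V → FormFiber V F G} {z : V} (h : f =ᶠ[𝓝 z] g) :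
    dbarModel f z = dbarModel g z := by
  simp only [dbarModel, antiDeriv_congr h]

theorem dbarModel_eventuallyEq {f g : V → FormFiber V F G} {z : V} (h : f =ᶠ[𝓝 z] g) :
    dbarModel f =ᶠ[𝓝 z] dbarModel g :=
  h.eventuallyEq_nhds.mono fun _ hx => dbarModel_congr hx

theorem dbarModel_add {f g : V → FormFiber V F G} {z : V} (hf : DifferentiableAt ℝ f z)
    (hg : DifferentiableAt ℝ g z) :
    dbarModel (fun z => f z + g z) z = dbarModel f z + dbarModel g z := by
  simp only [dbarModel, antiDeriv_add hf hg, map_add, Finset.sum_add_distrib]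

theorem dbarModel_mul {f : V → FormFiber V G H} {g : V → FormFiber V F G} {z : V}
    (hf : DifferentiableAt ℝ f z) (hg : DifferentiableAt ℝ g z) :
    dbarModel (fun z => mul (f z) (g z)) z =
      mul (dbarModel f z) (g z) + mul (rankSign (f z)) (dbarModel g z) := by
  simp only [dbarModel, antiDeriv_bilin hf hg, map_add, Finset.sum_add_distrib, map_sum,
    LinearMap.sum_apply, wedge_mul, mul_wedge, rankSign_rankSign]

theorem dbarModel_rankSign {f : V → FormFiber V F G} {z : V} (hf : DifferentiableAt ℝ f z) :
    dbarModel (fun z => rankSign (f z)) z = -rankSign (dbarModel f z) := by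
  simp only [dbarModel, antiDeriv_lin hf, map_sum, rankSign_wedge, Finset.sum_neg_distrib, neg_neg]

theorem dbarModel_ofHom {k : V → F →L[ℂ] G} {z : V} (hk : DifferentiableAt ℂ k z) :
    dbarModel (fun z => (ofHom (k z) : FormFiber V F G)) z = 0 := by
  have h : ∀ v, antiDeriv (fun z => (ofHom (k z) : FormFiber V F G)) z v = 0 := fun v => by
    rw [antiDeriv_lin (hk.restrictScalars ℝ), antiDeriv_eq_zero hk, map_zero]
  simp only [dbarModel, h, map_zero, Finset.sum_const_zero]

/-- a complex linear map applied to a smooth function is smooth -/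
theorem contDiffAt_lin {S S' : Type*} [NormedAddCommGroup S] [NormedSpace ℂ S]
    [FiniteDimensional ℂ S] [NormedAddCommGroup S'] [NormedSpace ℂ S'] {n : WithTop ℕ∞}
    {f : V → S} {z : V} (hf : ContDiffAt ℝ n f z) (B : S →ₗ[ℂ] S') :
    ContDiffAt ℝ n (fun z => B (f z)) z :=
  (realLin B).contDiff.contDiffAt.comp z hf

theorem differentiableAt_lin {S S' : Type*} [NormedAddCommGroup S] [NormedSpace ℂ S]
    [FiniteDimensional ℂ S] [NormedAddCommGroup S'] [NormedSpace ℂ S']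
    {f : V → S} {z : V} (hf : DifferentiableAt ℝ f z) (B : S →ₗ[ℂ] S') :
    DifferentiableAt ℝ (fun z => B (f z)) z :=
  (realLin B).differentiableAt.comp z hf

theorem contDiffAt_bilin {S S' S'' : Type*} [NormedAddCommGroup S] [NormedSpace ℂ S]
    [FiniteDimensional ℂ S] [NormedAddCommGroup S'] [NormedSpace ℂ S'] [FiniteDimensional ℂ S']
    [NormedAddCommGroup S''] [NormedSpace ℂ S''] {n : WithTop ℕ∞}
    {f : V → S} {g : V → S'} {z : V} (hf : ContDiffAt ℝ n f z) (hg : ContDiffAt ℝ n g z)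
    (B : S →ₗ[ℂ] S' →ₗ[ℂ] S'') : ContDiffAt ℝ n (fun z => B (f z) (g z)) z :=
  ((realBilin B).contDiff.contDiffAt.comp z hf).clm_apply hg

theorem contDiffAt_antiDeriv {S : Type*} [NormedAddCommGroup S] [NormedSpace ℂ S]
    {f : V → S} {z : V} (hf : ContDiffAt ℝ ∞ f z) (v : V) :
    ContDiffAt ℝ ∞ (fun z => antiDeriv f z v) z := by
  have h : ∀ w, ContDiffAt ℝ ∞ (fun z => fderiv ℝ f z w) z := fun w =>
    (hf.fderiv_right (m := ∞) (by simp)).clm_apply contDiffAt_const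
  exact ((h v).add ((h (Complex.I • v)).const_smul Complex.I)).const_smul (2⁻¹ : ℂ)

theorem contDiffAt_dbarModel {f : V → FormFiber V F G} {z : V} (hf : ContDiffAt ℝ ∞ f z) :
    ContDiffAt ℝ ∞ (dbarModel f) z :=
  ContDiffAt.sum fun _ _ => contDiffAt_lin (contDiffAt_antiDeriv hf _) _

theorem antiDeriv_antiDeriv_comm {S : Type*} [NormedAddCommGroup S] [NormedSpace ℂ S]
    {f : V → S} {z : V} (hf : ContDiffAt ℝ ∞ f z) (v w : V) :
    antiDeriv (fun z => antiDeriv f z v) z w = antiDeriv (fun z => antiDeriv f z w) z v := by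
  have hd : DifferentiableAt ℝ (fderiv ℝ f) z :=
    (hf.fderiv_right (m := 1) (by norm_cast)).differentiableAt one_ne_zero
  have hs : IsSymmSndFDerivAt ℝ f z := hf.isSymmSndFDerivAt (by
    rw [minSmoothness_of_isRCLikeNormedField]
    exact WithTop.coe_le_coe.mpr le_top)
  have h1 : ∀ w, DifferentiableAt ℝ (fun z => fderiv ℝ f z w) z := fun w =>
    hd.clm_apply (differentiableAt_const w)
  have h2 : ∀ w u, fderiv ℝ (fun z => fderiv ℝ f z w) z u = fderiv ℝ (fderiv ℝ f) z u w := by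
    intro w u
    rw [fderiv_clm_apply hd (differentiableAt_const w)]
    simp
  have h3 : ∀ v u, fderiv ℝ (fun z => antiDeriv f z v) z u = (2⁻¹ : ℂ) •
      (fderiv ℝ (fderiv ℝ f) z u v + Complex.I • fderiv ℝ (fderiv ℝ f) z u (Complex.I • v)) := by
    intro v u
    have h := (((h1 v).hasFDerivAt.add ((h1 (Complex.I • v)).hasFDerivAt.const_smul
      Complex.I)).const_smul (2⁻¹ : ℂ)).fderiv
    refine (congrArg (fun φ : V →L[ℝ] S => φ u) h).trans ?_
    simp only [_root_.smul_apply, _root_.add_apply, h2]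
  have hh : ∀ v w, antiDeriv (fun z => antiDeriv f z v) z w = (2⁻¹ : ℂ) •
    (fderiv ℝ (fun z => antiDeriv f z v) z w + Complex.I •
      fderiv ℝ (fun z => antiDeriv f z v) z (Complex.I • w)) := fun _ _ => rfl
  rw [hh, hh]
  simp only [h3]
  rw [hs.eq w v, hs.eq w (Complex.I • v), hs.eq (Complex.I • w) v,
    hs.eq (Complex.I • w) (Complex.I • v)]
  module

theorem sum_wedge_wedge_eq_zero
    {m : Fin (Module.finrank ℂ V) → Fin (Module.finrank ℂ V) → FormFiber V F G}
    (hm : ∀ i j, m i j = m j i) :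
    ∑ i, ∑ j, wedge (conjCoord V i) (wedge (conjCoord V j) (m j i)) = 0 := by
  set x := ∑ i, ∑ j, wedge (conjCoord V i) (wedge (conjCoord V j) (m j i)) with hx
  have h2 : x = -x := by
    conv_rhs => rw [hx, Finset.sum_comm]
    rw [← Finset.sum_neg_distrib]
    refine Finset.sum_congr rfl fun i _ => ?_
    rw [← Finset.sum_neg_distrib]
    refine Finset.sum_congr rfl fun j _ => ?_
    rw [wedge_wedge, hm]
  have h3 : (2 : ℂ) • x = 0 := by
    rw [two_smul]
    exact add_eq_zero_iff_eq_neg.mpr h2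
  exact (smul_eq_zero.mp h3).resolve_left two_ne_zero

theorem dbarModel_dbarModel {f : V → FormFiber V F G} {z : V} (hf : ContDiffAt ℝ ∞ f z) :
    dbarModel (dbarModel f) z = 0 := by
  have hdiff : ∀ v, DifferentiableAt ℝ (fun z => antiDeriv f z v) z := fun v =>
    (contDiffAt_antiDeriv hf v).differentiableAt (by simp)
  have h1 : ∀ u, antiDeriv (dbarModel f) z u = ∑ j, wedge (conjCoord V j)
      (antiDeriv (fun z => antiDeriv f z (Module.finBasis ℂ V j)) z u) := by
    intro u
    have hs : ∀ s : Finset (Fin (Module.finrank ℂ V)),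
        antiDeriv (fun z => ∑ i ∈ s, wedge (conjCoord V i)
          (antiDeriv f z (Module.finBasis ℂ V i))) z u = ∑ j ∈ s, wedge (conjCoord V j)
      (antiDeriv (fun z => antiDeriv f z (Module.finBasis ℂ V j)) z u) := by
      intro s
      induction s using Finset.induction_on with
      | empty => simp [antiDeriv]
      | insert a s ha ih =>
        simp only [Finset.sum_insert ha]
        rw [antiDeriv_add, ih, antiDeriv_lin (hdiff _)]
        · exact differentiableAt_lin (hdiff _) _
        · exact DifferentiableAt.fun_sum fun i _ => differentiableAt_lin (hdiff _) _
    exact hs Finset.univ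
  simp only [dbarModel.eq_def (dbarModel f), h1, map_sum]
  exact sum_wedge_wedge_eq_zero fun i j => antiDeriv_antiDeriv_comm hf _ _

theorem covector_eq_sum (u : V →L⋆[ℂ] ℂ) :
    u = ∑ j, u (Module.finBasis ℂ V j) • conjCoord V j := by
  ext x
  conv_lhs => rw [← (Module.finBasis ℂ V).sum_repr x]
  rw [map_sum, _root_.sum_apply]
  refine Finset.sum_congr rfl fun i _ => ?_
  rw [u.map_smulₛₗ, _root_.smul_apply, conjCoord_apply, smul_eq_mul, smul_eq_mul, mul_comm]

theorem antiDeriv_comp {S : Type*} [NormedAddCommGroup S] [NormedSpace ℂ S] {f : V → S}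
    {ψ : V → V} {z : V} (hf : DifferentiableAt ℝ f (ψ z)) (hψ : DifferentiableAt ℂ ψ z) (v : V) :
    antiDeriv (fun z => f (ψ z)) z v = antiDeriv f (ψ z) (fderiv ℂ ψ z v) := by
  have h : fderiv ℝ (fun z => f (ψ z)) z =
      (fderiv ℝ f (ψ z)).comp ((fderiv ℂ ψ z).restrictScalars ℝ) :=
    (hf.hasFDerivAt.comp z (hψ.hasFDerivAt.restrictScalars ℝ)).fderiv
  simp [antiDeriv, h]

theorem sum_wedge_comp (m : V → FormFiber V F G) (hadd : ∀ v w, m (v + w) = m v + m w)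
    (hsmul : ∀ (c : ℂ) v, m (c • v) = conj c • m v) (A : V →L[ℂ] V) :
    ∑ i, wedge ((conjCoord V i).comp A) (m (Module.finBasis ℂ V i)) =
      ∑ i, wedge (conjCoord V i) (m (A (Module.finBasis ℂ V i))) := by
  have hm : ∀ v, m v = ∑ j, conj ((Module.finBasis ℂ V).repr v j) • m (Module.finBasis ℂ V j) := by
    intro v
    let m' : V →ₗ⋆[ℂ] FormFiber V F G := ⟨⟨m, hadd⟩, hsmul⟩
    change m' v = _
    conv_lhs => rw [← (Module.finBasis ℂ V).sum_repr v]
    rw [map_sum]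
    exact Finset.sum_congr rfl fun i _ => m'.map_smulₛₗ _ _
  have h1 : ∀ i, (conjCoord V i).comp A =
      ∑ j, conj ((Module.finBasis ℂ V).repr (A (Module.finBasis ℂ V j)) i) • conjCoord V j :=
    fun i => covector_eq_sum _
  simp only [h1, map_sum, LinearMap.sum_apply, map_smul, LinearMap.smul_apply]
  rw [Finset.sum_comm]
  refine Finset.sum_congr rfl fun j _ => ?_
  conv_rhs => rw [hm (A (Module.finBasis ℂ V j))]
  rw [map_sum]
  exact Finset.sum_congr rfl fun i _ => by rw [map_smul]

theorem antiDeriv_add_right {S : Type*} [NormedAddCommGroup S] [NormedSpace ℂ S] (f : V → S)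
    (z v w : V) : antiDeriv f z (v + w) = antiDeriv f z v + antiDeriv f z w := by
  simp only [antiDeriv, smul_add, map_add]
  abel

end Dbar
end LG

namespace LG

section Transition

variable {V : Type*} [NormedAddCommGroup V] [NormedSpace ℂ V] [FiniteDimensional ℂ V]
  {F : Type*} [NormedAddCommGroup F] [NormedSpace ℂ F] [FiniteDimensional ℂ F]
  {G : Type*} [NormedAddCommGroup G] [NormedSpace ℂ G] [FiniteDimensional ℂ G]
  {F' : Type*} [NormedAddCommGroup F'] [NormedSpace ℂ F'] [FiniteDimensional ℂ F']
  {G' : Type*} [NormedAddCommGroup G'] [NormedSpace ℂ G'] [FiniteDimensional ℂ G']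

open FormFiber

theorem contDiffAt_ofHom {k : V → F →L[ℂ] G} {z : V} (hk : ContDiffAt ℂ ω k z) :
    ContDiffAt ℝ ∞ (fun z => (ofHom (k z) : FormFiber V F G)) z :=
  contDiffAt_lin ((hk.restrict_scalars ℝ).of_le le_top) _

theorem transition_gen {ψ : V → V} {A : V → V →L[ℂ] V} {z : V} (hψ : ContDiffAt ℂ ω ψ z)
    (hA : A =ᶠ[𝓝 z] fderiv ℂ ψ) (u : V →L⋆[ℂ] ℂ) :
    ContDiffAt ℝ ∞ (fun z => (wedge (u.comp (A z)) (ofHom (.id ℂ G)) : FormFiber V G G)) z ∧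
    dbarModel (fun z => (wedge (u.comp (A z)) (ofHom (.id ℂ G)) : FormFiber V G G)) z = 0 := by
  let B₀ : (V →L[ℂ] V) →ₗ[ℝ] FormFiber V G G :=
    { toFun := fun X => wedge (u.comp X) (ofHom (.id ℂ G))
      map_add' := fun X Y => by
        rw [ContinuousLinearMap.comp_add, map_add, LinearMap.add_apply]
      map_smul' := fun c X => by
        have h : u.comp (c • X) = (c : ℂ) • u.comp X := by
          ext v
          change u (c • X v) = (c : ℂ) • u (X v)
          rw [← Complex.coe_smul, u.map_smulₛₗ, Complex.conj_ofReal]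
        rw [h, map_smul, LinearMap.smul_apply, Complex.coe_smul, RingHom.id_apply] }
  let B : (V →L[ℂ] V) →L[ℝ] FormFiber V G G := LinearMap.toContinuousLinearMap B₀
  have hBA : ∀ X : V →L[ℂ] V, B X = wedge (u.comp X) (ofHom (.id ℂ G)) := fun _ => rfl
  have hBI : ∀ X : V →L[ℂ] V, Complex.I • B (Complex.I • X) = B X := by
    intro X
    have h : u.comp (Complex.I • X) = (-Complex.I) • u.comp X := by
      ext v
      simp
    rw [hBA, hBA, h, map_smul, LinearMap.smul_apply, smul_smul]
    simp
  have hA' : ContDiffAt ℂ ω A z := (hψ.fderiv_right (m := ω) le_rfl).congr_of_eventuallyEq hA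
  have hA'' : ContDiffAt ℝ ∞ A z := (hA'.restrict_scalars ℝ).of_le le_top
  refine ⟨B.contDiff.contDiffAt.comp z hA'', ?_⟩
  have hAd : DifferentiableAt ℂ A z := hA'.differentiableAt (by simp)
  have hsymm : IsSymmSndFDerivAt ℂ ψ z := hψ.isSymmSndFDerivAt (by
    rw [minSmoothness_of_isRCLikeNormedField]
    exact le_top)
  have hder : ∀ v, antiDeriv (fun z => B (A z)) z v = B (fderiv ℂ (fderiv ℂ ψ) z v) := by
    intro v
    have h : fderiv ℝ (fun z => B (A z)) z = B.comp ((fderiv ℂ A z).restrictScalars ℝ) :=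
      (B.hasFDerivAt.comp z (hAd.hasFDerivAt.restrictScalars ℝ)).fderiv
    rw [antiDeriv, h, ← hA.fderiv_eq]
    simp only [ContinuousLinearMap.comp_apply, ContinuousLinearMap.coe_restrictScalars', map_smul]
    rw [hBI, ← two_smul ℂ, smul_smul]
    simp
  change dbarModel (fun z => B (A z)) z = 0
  simp only [dbarModel, hder]
  simp only [hBA]
  have hexp : ∀ i, u.comp (fderiv ℂ (fderiv ℂ ψ) z (Module.finBasis ℂ V i)) =
      ∑ j, u (fderiv ℂ (fderiv ℂ ψ) z (Module.finBasis ℂ V i) (Module.finBasis ℂ V j)) •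
        conjCoord V j := fun i => covector_eq_sum _
  simp only [hexp, map_sum, LinearMap.sum_apply, map_smul, LinearMap.smul_apply]
  have := sum_wedge_wedge_eq_zero (V := V) (F := G) (G := G) (m := fun j i =>
    u (fderiv ℂ (fderiv ℂ ψ) z (Module.finBasis ℂ V i) (Module.finBasis ℂ V j)) •
      ofHom (.id ℂ G)) (fun i j => by rw [hsymm.eq])
  simpa only [map_smul] using this

theorem transition_ext {ψ : V → V} {A : V → V →L[ℂ] V} {z : V} (hψ : ContDiffAt ℂ ω ψ z)
    (hA : A =ᶠ[𝓝 z] fderiv ℂ ψ) (ρ : AntiExt V) :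
    ContDiffAt ℝ ∞ (fun z => (tmul (ExteriorAlgebra.map (pullCovector (A z)) ρ) (.id ℂ G) :
      FormFiber V G G)) z ∧
    dbarModel (fun z => (tmul (ExteriorAlgebra.map (pullCovector (A z)) ρ) (.id ℂ G) :
      FormFiber V G G)) z = 0 := by
  induction ρ using ExteriorAlgebra.induction with
  | algebraMap r =>
    simp only [AlgHom.commutes]
    refine ⟨contDiffAt_const, ?_⟩
    simp [dbarModel, antiDeriv]
  | ι u =>
    have h : ∀ z, (tmul (ExteriorAlgebra.map (pullCovector (A z)) (ExteriorAlgebra.ι ℂ u))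
        (.id ℂ G) : FormFiber V G G) = wedge (u.comp (A z)) (ofHom (.id ℂ G)) := by
      intro z
      rw [ExteriorAlgebra.map_apply_ι, ofHom_eq, wedge_tmul, _root_.mul_one]
      rfl
    simp only [h]
    exact transition_gen hψ hA u
  | mul ρ η hρ hη =>
    have h : ∀ z, (tmul (ExteriorAlgebra.map (pullCovector (A z)) (ρ * η)) (.id ℂ G) :
        FormFiber V G G) = mul (tmul (ExteriorAlgebra.map (pullCovector (A z)) ρ) (.id ℂ G))
          (tmul (ExteriorAlgebra.map (pullCovector (A z)) η) (.id ℂ G)) := by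
      intro z
      rw [_root_.map_mul, mul_tmul, ContinuousLinearMap.id_comp]
    simp only [h]
    refine ⟨contDiffAt_bilin hρ.1 hη.1 _, ?_⟩
    rw [dbarModel_mul (hρ.1.differentiableAt (by simp)) (hη.1.differentiableAt (by simp)), hρ.2,
      hη.2]
    simp
  | add ρ η hρ hη =>
    have h : ∀ z, (tmul (ExteriorAlgebra.map (pullCovector (A z)) (ρ + η)) (.id ℂ G) :
        FormFiber V G G) = tmul (ExteriorAlgebra.map (pullCovector (A z)) ρ) (.id ℂ G) +
          tmul (ExteriorAlgebra.map (pullCovector (A z)) η) (.id ℂ G) := by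
      intro z
      rw [map_add]
      exact TensorProduct.add_tmul _ _ _
    simp only [h]
    refine ⟨hρ.1.add hη.1, ?_⟩
    rw [dbarModel_add (hρ.1.differentiableAt (by simp)) (hη.1.differentiableAt (by simp)), hρ.2,
      hη.2, add_zero]

theorem transition_const {ψ : V → V} {A : V → V →L[ℂ] V} {a : V → F' →L[ℂ] F}
    {b : V → G →L[ℂ] G'} {z : V} (hψ : ContDiffAt ℂ ω ψ z) (hA : A =ᶠ[𝓝 z] fderiv ℂ ψ)
    (ha : ContDiffAt ℂ ω a z) (hb : ContDiffAt ℂ ω b z) (x : FormFiber V F G) :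
    ContDiffAt ℝ ∞ (fun z => map (A z) (a z) (b z) x) z ∧
    dbarModel (fun z => map (A z) (a z) (b z) x) z = 0 := by
  induction x using FormFiber.induction with
  | h0 =>
    simp only [map_zero]
    refine ⟨contDiffAt_const, ?_⟩
    simp [dbarModel, antiDeriv]
  | ha x y hx hy =>
    simp only [map_add]
    refine ⟨hx.1.add hy.1, ?_⟩
    rw [dbarModel_add (hx.1.differentiableAt (by simp)) (hy.1.differentiableAt (by simp)), hx.2,
      hy.2, add_zero]
  | ht ρ f =>
    have h : ∀ z, map (A z) (a z) (b z) (tmul ρ f) =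
        mul (tmul (ExteriorAlgebra.map (pullCovector (A z)) ρ) (.id ℂ G'))
          (ofHom ((b z).comp (f.comp (a z)))) := by
      intro z
      rw [map_tmul, ofHom_eq, mul_tmul, _root_.mul_one, ContinuousLinearMap.id_comp]
    simp only [h]
    obtain ⟨h1, h2⟩ := transition_ext (G := G') hψ hA ρ
    have h3 : ContDiffAt ℂ ω (fun z => (b z).comp (f.comp (a z))) z :=
      hb.clm_comp (contDiffAt_const.clm_comp ha)
    refine ⟨contDiffAt_bilin h1 (contDiffAt_ofHom h3) _, ?_⟩
    rw [dbarModel_mul (h1.differentiableAt (by simp))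
      ((contDiffAt_ofHom h3).differentiableAt (by simp)), h2,
      dbarModel_ofHom (h3.differentiableAt (by simp))]
    simp

/-- The Dolbeault operator commutes with holomorphic coordinate changes and holomorphic changes of
frame. -/
theorem transition {ψ : V → V} {A : V → V →L[ℂ] V} {a : V → F' →L[ℂ] F}
    {b : V → G →L[ℂ] G'} {z : V} (hψ : ContDiffAt ℂ ω ψ z) (hA : A =ᶠ[𝓝 z] fderiv ℂ ψ)
    (ha : ContDiffAt ℂ ω a z) (hb : ContDiffAt ℂ ω b z) {f : V → FormFiber V F G}
    (hf : ContDiffAt ℝ ∞ f (ψ z)) :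
    ContDiffAt ℝ ∞ (fun z => map (A z) (a z) (b z) (f (ψ z))) z ∧
    dbarModel (fun z => map (A z) (a z) (b z) (f (ψ z))) z =
      map (A z) (a z) (b z) (dbarModel f (ψ z)) := by
  let m := Module.finBasis ℂ (FormFiber V F G)
  have hexp : ∀ z, map (A z) (a z) (b z) (f (ψ z)) =
      ∑ j, m.coord j (f (ψ z)) • map (A z) (a z) (b z) (m j) := by
    intro z
    conv_lhs => rw [← m.sum_repr (f (ψ z))]
    rw [map_sum]
    exact Finset.sum_congr rfl fun j _ => map_smul _ _ _
  have hfψ : ContDiffAt ℝ ∞ (fun z => f (ψ z)) z :=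
    hf.comp z ((hψ.restrict_scalars ℝ).of_le le_top)
  have hc : ∀ j, ContDiffAt ℝ ∞ (fun z => m.coord j (f (ψ z))) z := fun j =>
    contDiffAt_lin hfψ (m.coord j)
  have hm := fun j => transition_const hψ hA ha hb (m j)
  have hprod : ∀ j, ContDiffAt ℝ ∞
      (fun z => m.coord j (f (ψ z)) • map (A z) (a z) (b z) (m j)) z := fun j =>
    contDiffAt_bilin (hc j) (hm j).1 (LinearMap.lsmul ℂ (FormFiber V F' G'))
  simp only [hexp]
  refine ⟨ContDiffAt.sum fun j _ => hprod j, ?_⟩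
  have hsum : ∀ s : Finset (Fin (Module.finrank ℂ (FormFiber V F G))),
      dbarModel (fun z => ∑ j ∈ s, m.coord j (f (ψ z)) • map (A z) (a z) (b z) (m j)) z =
      ∑ j ∈ s, ∑ i, wedge (conjCoord V i)
        (antiDeriv (fun z => m.coord j (f (ψ z))) z (Module.finBasis ℂ V i) •
          map (A z) (a z) (b z) (m j)) := by
    intro s
    induction s using Finset.induction_on with
    | empty => simp [dbarModel, antiDeriv]
    | insert j s hj ih =>
      simp only [Finset.sum_insert hj]
      rw [dbarModel_add ((hprod j).differentiableAt (by simp))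
        ((ContDiffAt.sum fun j _ => hprod j).differentiableAt (by simp)), ih]
      congr 1
      have h1 : ∀ v, antiDeriv (fun z => m.coord j (f (ψ z)) • map (A z) (a z) (b z) (m j)) z v =
          antiDeriv (fun z => m.coord j (f (ψ z))) z v • map (A z) (a z) (b z) (m j) +
          m.coord j (f (ψ z)) • antiDeriv (fun z => map (A z) (a z) (b z) (m j)) z v := fun v =>
        antiDeriv_bilin ((hc j).differentiableAt (by simp))
          ((hm j).1.differentiableAt (by simp)) (LinearMap.lsmul ℂ (FormFiber V F' G')) v
      simp only [dbarModel, h1, map_add, Finset.sum_add_distrib, map_smul]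
      rw [← Finset.smul_sum]
      have h2 := (hm j).2
      rw [dbarModel] at h2
      rw [h2, smul_zero, add_zero]
  rw [hsum, Finset.sum_comm]
  have h4 : ∀ v, ∑ j, antiDeriv (fun z => m.coord j (f (ψ z))) z v • map (A z) (a z) (b z) (m j) =
      map (A z) (a z) (b z) (antiDeriv f (ψ z) (A z v)) := by
    intro v
    rw [hA.self_of_nhds, ← antiDeriv_comp (hf.differentiableAt (by simp))
      (hψ.differentiableAt (by simp)) v]
    conv_rhs => rw [← m.sum_repr (antiDeriv (fun z => f (ψ z)) z v)]
    rw [map_sum]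
    refine Finset.sum_congr rfl fun j _ => ?_
    rw [antiDeriv_lin (hfψ.differentiableAt (by simp)) (m.coord j), map_smul]
    rfl
  simp only [← map_sum, h4]
  rw [dbarModel, map_sum]
  simp only [map_wedge]
  exact (sum_wedge_comp (fun v => map (A z) (a z) (b z) (antiDeriv f (ψ z) v))
    (fun v w => by rw [antiDeriv_add_right, map_add])
    (fun c v => by rw [antiDeriv_smul_right, map_smul]) (A z)).symm

end Transition
end LG

namespace LG

section Bundles

universe u v w

variable (V : Type u) [NormedAddCommGroup V] [NormedSpace ℂ V] [FiniteDimensional ℂ V]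
  (X : Type v) [TopologicalSpace X] [ChartedSpace V X] [IsManifold 𝓘(ℂ, V) ω X]

/-- A holomorphic vector bundle of finite rank on the complex manifold `X`. -/
structure HolBundle where
  /-- the model fiber -/
  F : Type w
  [normF : NormedAddCommGroup F]
  [spaceF : NormedSpace ℂ F]
  [finF : FiniteDimensional ℂ F]
  /-- the fibers -/
  E : X → Type w
  [addE : ∀ x, AddCommGroup (E x)]
  [modE : ∀ x, Module ℂ (E x)]
  [topE : ∀ x, TopologicalSpace (E x)]
  [topAddE : ∀ x, IsTopologicalAddGroup (E x)]
  [smulE : ∀ x, ContinuousSMul ℂ (E x)]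
  [topTotal : TopologicalSpace (TotalSpace F E)]
  [fiberBundle : FiberBundle F E]
  [vectorBundle : VectorBundle ℂ F E]
  [holomorphic : ContMDiffVectorBundle ω F E 𝓘(ℂ, V)]

attribute [instance] HolBundle.normF HolBundle.spaceF HolBundle.finF HolBundle.addE HolBundle.modE
  HolBundle.topE HolBundle.topAddE HolBundle.smulE HolBundle.topTotal HolBundle.fiberBundle
  HolBundle.vectorBundle HolBundle.holomorphic

variable {V X}

/-- A field of fiberwise linear maps between two holomorphic vector bundles is holomorphic if it is
holomorphic as a section of the bundle `Hom(A, B)`. -/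
def IsHolHom (A B : HolBundle.{u, v, w} V X) (f : ∀ x, A.E x →L[ℂ] B.E x) : Prop :=
  ContMDiff 𝓘(ℂ, V) (𝓘(ℂ, V).prod 𝓘(ℂ, A.F →L[ℂ] B.F)) ω
    (fun x => TotalSpace.mk' (A.F →L[ℂ] B.F) (E := fun x => A.E x →L[ℂ] B.E x) x (f x))

/-- A section of `∧ T̄*X ⊗ Hom(A, B)`, with no regularity assumed. -/
abbrev RawForm (A B : HolBundle.{u, v, w} V X) : Type _ :=
  ∀ x, FormFiber (TangentSpace 𝓘(ℂ, V) x) (A.E x) (B.E x)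

variable {A B C D : HolBundle.{u, v, w} V X}

/-- The expression at `y` of an element of the fiber at `y` of `∧ T̄*X ⊗ Hom(A, B)` in the preferred
chart of `X` and the preferred trivializations of `A` and `B` at `p`. -/
def toModel (p y : X) :
    FormFiber (TangentSpace 𝓘(ℂ, V) y) (A.E y) (B.E y) →ₗ[ℂ] FormFiber V A.F B.F :=
  FormFiber.map ((trivializationAt V (TangentSpace 𝓘(ℂ, V)) p).symmL ℂ y)
    ((trivializationAt A.F A.E p).symmL ℂ y)
    ((trivializationAt B.F B.E p).continuousLinearMapAt ℂ y)

/-- The inverse of `toModel p y`, for `y` in the domain of the chart and of the trivializations. -/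
def ofModel (p y : X) :
    FormFiber V A.F B.F →ₗ[ℂ] FormFiber (TangentSpace 𝓘(ℂ, V) y) (A.E y) (B.E y) :=
  FormFiber.map ((trivializationAt V (TangentSpace 𝓘(ℂ, V)) p).continuousLinearMapAt ℂ y)
    ((trivializationAt A.F A.E p).continuousLinearMapAt ℂ y)
    ((trivializationAt B.F B.E p).symmL ℂ y)

/-- The local expression of a form in the preferred chart and trivializations at `p`. -/
def rep (p : X) (α : RawForm A B) (z : V) : FormFiber V A.F B.F :=
  toModel p ((chartAt V p).symm z) (α ((chartAt V p).symm z))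

/-- A form is smooth if its local expressions are smooth functions. -/
def IsSmooth (α : RawForm A B) : Prop :=
  ∀ p, ContDiffAt ℝ ∞ (rep p α) (chartAt V p p)

/-- The Dolbeault operator `∂̄` of `Hom(A, B)`: in holomorphic coordinates and holomorphic frames,
it is `∑ᵢ dz̄ⁱ ∧ ∂/∂z̄ⁱ`. -/
def dbar (α : RawForm A B) : RawForm A B := fun x =>
  ofModel x x (dbarModel (rep x α) (chartAt V x x))

variable (A B) in
/-- The common domain of the preferred chart at `p` and the trivializations of `A`, `B` at `p`. -/
def dom (p : X) : Set X :=
  (chartAt V p).source ∩ ((trivializationAt A.F A.E p).baseSet ∩ (trivializationAt B.F B.E p).baseSet)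

theorem isOpen_dom (p : X) : IsOpen (dom A B p) :=
  (chartAt V p).open_source.inter ((trivializationAt A.F A.E p).open_baseSet.inter
    (trivializationAt B.F B.E p).open_baseSet)

theorem mem_dom (p : X) : p ∈ dom A B p :=
  ⟨mem_chart_source V p, FiberBundle.mem_baseSet_trivializationAt' p,
    FiberBundle.mem_baseSet_trivializationAt' p⟩

theorem eventually_dom {p y : X} (hy : y ∈ dom A B p) :
    ∀ᶠ z in 𝓝 (chartAt V p y), z ∈ (chartAt V p).target ∧ (chartAt V p).symm z ∈ dom A B p ∧
      (chartAt V p).symm z ∈ dom A B y := by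
  have ht : chartAt V p y ∈ (chartAt V p).target := (chartAt V p).map_source hy.1
  have hc := (chartAt V p).continuousAt_symm ht
  have hs : (chartAt V p).symm (chartAt V p y) = y := (chartAt V p).left_inv hy.1
  have hT : ∀ᶠ z in 𝓝 (chartAt V p y), z ∈ (chartAt V p).target :=
    (chartAt V p).open_target.mem_nhds ht
  refine hT.and (Filter.Eventually.and ?_ ?_)
  · exact hc.eventually_mem ((isOpen_dom p).mem_nhds (hs.symm ▸ hy))
  · exact hc.eventually_mem ((isOpen_dom y).mem_nhds (hs.symm ▸ mem_dom y))

theorem toModel_ofModel {p y : X} (hy : y ∈ dom A B p) (x : FormFiber V A.F B.F) :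
    toModel p y (ofModel p y x) = x := by
  have h1 : (trivializationAt V (TangentSpace 𝓘(ℂ, V)) p).continuousLinearMapAt ℂ y ∘L
      (trivializationAt V (TangentSpace 𝓘(ℂ, V)) p).symmL ℂ y = .id ℂ V := by
    ext v
    exact Trivialization.continuousLinearMapAt_symmL _ hy.1 v
  have h2 : (trivializationAt A.F A.E p).continuousLinearMapAt ℂ y ∘L
      (trivializationAt A.F A.E p).symmL ℂ y = .id ℂ A.F := by
    ext v
    exact Trivialization.continuousLinearMapAt_symmL _ hy.2.1 v
  have h3 : (trivializationAt B.F B.E p).continuousLinearMapAt ℂ y ∘L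
      (trivializationAt B.F B.E p).symmL ℂ y = .id ℂ B.F := by
    ext v
    exact Trivialization.continuousLinearMapAt_symmL _ hy.2.2 v
  rw [toModel, ofModel, FormFiber.map_map, h1, h2, h3, FormFiber.map_id]

theorem ofModel_toModel {p y : X} (hy : y ∈ dom A B p)
    (x : FormFiber (TangentSpace 𝓘(ℂ, V) y) (A.E y) (B.E y)) :
    ofModel p y (toModel p y x) = x := by
  have h1 : (trivializationAt V (TangentSpace 𝓘(ℂ, V)) p).symmL ℂ y ∘L
      (trivializationAt V (TangentSpace 𝓘(ℂ, V)) p).continuousLinearMapAt ℂ y = .id ℂ _ := by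
    ext v
    exact Trivialization.symmL_continuousLinearMapAt _ hy.1 v
  have h2 : (trivializationAt A.F A.E p).symmL ℂ y ∘L
      (trivializationAt A.F A.E p).continuousLinearMapAt ℂ y = .id ℂ _ := by
    ext v
    exact Trivialization.symmL_continuousLinearMapAt _ hy.2.1 v
  have h3 : (trivializationAt B.F B.E p).symmL ℂ y ∘L
      (trivializationAt B.F B.E p).continuousLinearMapAt ℂ y = .id ℂ _ := by
    ext v
    exact Trivialization.symmL_continuousLinearMapAt _ hy.2.2 v
  rw [toModel, ofModel, FormFiber.map_map, h1, h2, h3, FormFiber.map_id]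

/-- the coordinate change between the preferred charts -/
def chg (p y : X) (z : V) : V := chartAt V y ((chartAt V p).symm z)

theorem contDiffAt_chg {p y x : X} (hp : x ∈ (chartAt V p).source) (hy : x ∈ (chartAt V y).source) :
    ContDiffAt ℂ ω (chg p y) (chartAt V p x) := by
  have h1 : ContMDiffAt 𝓘(ℂ, V) 𝓘(ℂ, V) ω (chartAt V p).symm (chartAt V p x) :=
    contMDiffOn_chart_symm.contMDiffAt
      ((chartAt V p).open_target.mem_nhds ((chartAt V p).map_source hp))
  have h2 : ContMDiffAt 𝓘(ℂ, V) 𝓘(ℂ, V) ω (chartAt V y) x :=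
    contMDiffOn_chart.contMDiffAt ((chartAt V y).open_source.mem_nhds hy)
  have h3 : ContMDiffAt 𝓘(ℂ, V) 𝓘(ℂ, V) ω (chartAt V y)
      ((chartAt V p).symm (chartAt V p x)) := by rwa [(chartAt V p).left_inv hp]
  exact contMDiffAt_iff_contDiffAt.1 (h3.comp _ h1)

/-- the differential of the coordinate change -/
def chgT (p y : X) (z : V) : V →L[ℂ] V :=
  (trivializationAt V (TangentSpace 𝓘(ℂ, V)) y).continuousLinearMapAt ℂ ((chartAt V p).symm z) ∘L
    (trivializationAt V (TangentSpace 𝓘(ℂ, V)) p).symmL ℂ ((chartAt V p).symm z)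

theorem chgT_eq {p y : X} {z : V} (hz : z ∈ (chartAt V p).target)
    (hy : (chartAt V p).symm z ∈ (chartAt V y).source) :
    chgT p y z = fderiv ℂ (chg p y) z := by
  set x := (chartAt V p).symm z with hx
  have hp : x ∈ (chartAt V p).source := (chartAt V p).map_target hz
  have h : HasFDerivWithinAt ((extChartAt 𝓘(ℂ, V) y) ∘ (extChartAt 𝓘(ℂ, V) p).symm)
      (tangentCoordChange 𝓘(ℂ, V) p y x) (range 𝓘(ℂ, V)) (extChartAt 𝓘(ℂ, V) p x) :=
    hasFDerivWithinAt_tangentCoordChange (by simp only [extChartAt_source]; exact ⟨hp, hy⟩)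
  have hz' : extChartAt 𝓘(ℂ, V) p x = z := by
    simp [hx, (chartAt V p).right_inv hz]
  rw [hz'] at h
  simp only [modelWithCornersSelf_coe, range_id, hasFDerivWithinAt_univ] at h
  have h2 : (extChartAt 𝓘(ℂ, V) y) ∘ (extChartAt 𝓘(ℂ, V) p).symm = chg p y := by
    ext z
    simp [chg]
  rw [h2] at h
  rw [h.fderiv]
  ext v
  rw [chgT, ContinuousLinearMap.comp_apply]
  have e1 := TangentBundle.continuousLinearMapAt_trivializationAt_eq_core (I := 𝓘(ℂ, V)) hy
  have e2 := TangentBundle.symmL_trivializationAt_eq_core (I := 𝓘(ℂ, V)) hp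
  rw [← hx, e1, e2]
  exact tangentCoordChange_comp (I := 𝓘(ℂ, V)) (w := p) (x := x) (y := y) (z := x) (v := v)
    (by simp only [extChartAt_source]; exact ⟨⟨hp, mem_chart_source V x⟩, hy⟩)

/-- the change of frame of a holomorphic vector bundle, in coordinates -/
def chgF (A : HolBundle.{u, v, w} V X) (p q r : X) (z : V) : A.F →L[ℂ] A.F :=
  (trivializationAt A.F A.E r).continuousLinearMapAt ℂ ((chartAt V p).symm z) ∘L
    (trivializationAt A.F A.E q).symmL ℂ ((chartAt V p).symm z)

theorem contDiffAt_chgF {p q r x : X} (hp : x ∈ (chartAt V p).source)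
    (hq : x ∈ (trivializationAt A.F A.E q).baseSet)
    (hr : x ∈ (trivializationAt A.F A.E r).baseSet) :
    ContDiffAt ℂ ω (chgF A p q r) (chartAt V p x) := by
  have ht := (chartAt V p).map_source hp
  have hs : (chartAt V p).symm (chartAt V p x) = x := (chartAt V p).left_inv hp
  have h1 : ContMDiffAt 𝓘(ℂ, V) 𝓘(ℂ, V) ω (chartAt V p).symm (chartAt V p x) :=
    contMDiffOn_chart_symm.contMDiffAt ((chartAt V p).open_target.mem_nhds ht)
  have h2 : ContMDiffAt 𝓘(ℂ, V) 𝓘(ℂ, A.F →L[ℂ] A.F) ω (fun b : X =>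
      ((trivializationAt A.F A.E q).coordChangeL ℂ (trivializationAt A.F A.E r) b :
        A.F →L[ℂ] A.F)) ((chartAt V p).symm (chartAt V p x)) := by
    rw [hs]
    exact contMDiffAt_coordChangeL hq hr
  have h3 := contMDiffAt_iff_contDiffAt.1 (h2.comp _ h1)
  refine h3.congr_of_eventuallyEq ?_
  have hc := (chartAt V p).continuousAt_symm ht
  have hU : (trivializationAt A.F A.E q).baseSet ∩ (trivializationAt A.F A.E r).baseSet ∈ 𝓝 x :=
    ((trivializationAt A.F A.E q).open_baseSet.inter
      (trivializationAt A.F A.E r).open_baseSet).mem_nhds ⟨hq, hr⟩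
  filter_upwards [hc.eventually_mem (hs.symm ▸ hU)] with z hz
  ext v
  rw [chgF, ContinuousLinearMap.comp_apply, Trivialization.symmL_apply _ hz.1]
  simp only [Function.comp_apply, ContinuousLinearEquiv.coe_coe]
  rw [Trivialization.coordChangeL_apply _ _ hz, Trivialization.continuousLinearMapAt_apply,
    Trivialization.linearMapAt_apply, if_pos hz.2]

theorem rep_eventuallyEq (α : RawForm A B) {p y : X} (hy : y ∈ dom A B p) :
    rep p α =ᶠ[𝓝 (chartAt V p y)] fun z =>
      FormFiber.map (chgT p y z) (chgF A p p y z) (chgF B p y p z) (rep y α (chg p y z)) := by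
  filter_upwards [eventually_dom hy] with z ⟨hz, hp, hy⟩
  set x := (chartAt V p).symm z with hx
  have h : (chartAt V y).symm (chg p y z) = x := (chartAt V y).left_inv hy.1
  have h' : rep y α (chg p y z) = toModel y x (α x) :=
    congrArg (fun x => toModel y x (α x)) h
  have h1 : (trivializationAt V (TangentSpace 𝓘(ℂ, V)) y).symmL ℂ x ∘L chgT p y z =
      (trivializationAt V (TangentSpace 𝓘(ℂ, V)) p).symmL ℂ x := by
    ext v
    exact Trivialization.symmL_continuousLinearMapAt _ hy.1 _
  have h2 : (trivializationAt A.F A.E y).symmL ℂ x ∘L chgF A p p y z =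
      (trivializationAt A.F A.E p).symmL ℂ x := by
    ext v
    exact Trivialization.symmL_continuousLinearMapAt _ hy.2.1 _
  have h3 : chgF B p y p z ∘L (trivializationAt B.F B.E y).continuousLinearMapAt ℂ x =
      (trivializationAt B.F B.E p).continuousLinearMapAt ℂ x := by
    ext v
    exact congrArg _ (Trivialization.symmL_continuousLinearMapAt _ hy.2.2 _)
  rw [h', toModel, FormFiber.map_map, h1, h2, h3]
  rfl

theorem chg_apply {p y : X} (hy : y ∈ (chartAt V p).source) :
    chg p y (chartAt V p y) = chartAt V y y := by
  rw [chg, (chartAt V p).left_inv hy]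

theorem chgT_eventuallyEq {p y : X} (hy : y ∈ dom A B p) :
    chgT p y =ᶠ[𝓝 (chartAt V p y)] fderiv ℂ (chg p y) :=
  (eventually_dom hy).mono fun _ h => chgT_eq h.1 h.2.2.1

theorem IsSmooth.transition {α : RawForm A B} (hα : IsSmooth α) {p y : X} (hy : y ∈ dom A B p) :
    ContDiffAt ℝ ∞ (rep p α) (chartAt V p y) ∧
      toModel p y (dbar α y) = dbarModel (rep p α) (chartAt V p y) := by
  have hd := mem_dom (A := A) (B := B) y
  have h := LG.transition (contDiffAt_chg hy.1 hd.1) (chgT_eventuallyEq hy)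
    (contDiffAt_chgF (A := A) hy.1 hy.2.1 hd.2.1) (contDiffAt_chgF (A := B) hy.1 hd.2.2 hy.2.2)
    (f := rep y α) (by rw [chg_apply hy.1]; exact hα y)
  have he := rep_eventuallyEq α hy
  refine ⟨h.1.congr_of_eventuallyEq he, ?_⟩
  rw [dbarModel_congr he, h.2, chg_apply hy.1, dbar, toModel, ofModel, FormFiber.map_map, chgT, chgF,
    chgF, (chartAt V p).left_inv hy.1]

theorem rep_dbar {α : RawForm A B} (hα : IsSmooth α) {p y : X} (hy : y ∈ dom A B p) :
    rep p (dbar α) =ᶠ[𝓝 (chartAt V p y)] dbarModel (rep p α) := by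
  filter_upwards [eventually_dom hy] with z hz
  rw [rep, (hα.transition hz.2.1).2, (chartAt V p).right_inv hz.1]

theorem IsSmooth.dbar {α : RawForm A B} (hα : IsSmooth α) : IsSmooth (dbar α) := fun p =>
  (contDiffAt_dbarModel (hα p)).congr_of_eventuallyEq (rep_dbar hα (mem_dom p))

/-- A form is determined at `x` by its local expression there. -/
theorem eq_of_toModel {x : X} {α β : FormFiber (TangentSpace 𝓘(ℂ, V) x) (A.E x) (B.E x)}
    (h : toModel x x α = toModel x x β) : α = β := by
  rw [← ofModel_toModel (mem_dom x) α, h, ofModel_toModel (mem_dom x)]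

theorem toModel_dbar (α : RawForm A B) (x : X) :
    toModel x x (dbar α x) = dbarModel (rep x α) (chartAt V x x) :=
  toModel_ofModel (mem_dom x) _

theorem dbar_dbar {α : RawForm A B} (hα : IsSmooth α) : dbar (dbar α) = 0 := by
  funext x
  apply eq_of_toModel
  rw [toModel_dbar, dbarModel_congr (rep_dbar hα (mem_dom x)), dbarModel_dbarModel (hα x)]
  exact (map_zero _).symm

end Bundles
end LG

namespace LG

section Forms

universe u v w

variable {V : Type u} [NormedAddCommGroup V] [NormedSpace ℂ V] [FiniteDimensional ℂ V]
  {X : Type v} [TopologicalSpace X] [ChartedSpace V X] [IsManifold 𝓘(ℂ, V) ω X]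
  {A B C D : HolBundle.{u, v, w} V X}

open FormFiber

theorem dbar_congr_of_rep {α : RawForm A B} {f : V → FormFiber V A.F B.F} {x : X}
    (h : rep x α =ᶠ[𝓝 (chartAt V x x)] f) :
    toModel x x (dbar α x) = dbarModel f (chartAt V x x) := by
  rw [toModel_dbar, dbarModel_congr h]

theorem rep_self (p : X) (α : RawForm A B) : rep p α (chartAt V p p) = toModel p p (α p) :=
  congrArg (fun x => toModel p x (α x)) ((chartAt V p).left_inv (mem_chart_source V p))

theorem toModel_mul {p y : X} (hy : y ∈ dom A B p)
    (a : FormFiber (TangentSpace 𝓘(ℂ, V) y) (B.E y) (C.E y))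
    (b : FormFiber (TangentSpace 𝓘(ℂ, V) y) (A.E y) (B.E y)) :
    toModel p y (mul a b) = mul (toModel p y a) (toModel p y b) := by
  have h2 : (trivializationAt B.F B.E p).symmL ℂ y ∘L
      (trivializationAt B.F B.E p).continuousLinearMapAt ℂ y = .id ℂ _ := by
    ext v
    exact Trivialization.symmL_continuousLinearMapAt _ hy.2.2 v
  exact FormFiber.map_mul _ _ _ _ _ h2 a b

theorem rep_mul (p : X) (α : RawForm B C) (β : RawForm A B) :
    rep p (fun x => mul (α x) (β x)) =ᶠ[𝓝 (chartAt V p p)]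
      fun z => mul (rep p α z) (rep p β z) := by
  filter_upwards [eventually_dom (mem_dom (A := A) (B := B) p)] with z hz
  exact toModel_mul hz.2.1 _ _

theorem rep_rankSign (p : X) (α : RawForm A B) :
    rep p (fun x => rankSign (α x)) = fun z => rankSign (rep p α z) :=
  funext fun _ => map_rankSign _ _ _ _

theorem rep_ofHom {f : ∀ x, A.E x →L[ℂ] B.E x} (hf : IsHolHom A B f) (p : X) :
    ∃ k : V → A.F →L[ℂ] B.F, ContDiffAt ℂ ω k (chartAt V p p) ∧
      rep p (fun x => ofHom (f x)) = fun z => ofHom (k z) := by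
  have h := ((contMDiffAt_hom_bundle _).1 (hf p)).2
  have ht := (chartAt V p).map_source (mem_chart_source V p)
  have hs : (chartAt V p).symm (chartAt V p p) = p := (chartAt V p).left_inv (mem_chart_source V p)
  have h1 : ContMDiffAt 𝓘(ℂ, V) 𝓘(ℂ, V) ω (chartAt V p).symm (chartAt V p p) :=
    contMDiffOn_chart_symm.contMDiffAt ((chartAt V p).open_target.mem_nhds ht)
  rw [← hs] at h
  refine ⟨_, contMDiffAt_iff_contDiffAt.1 (h.comp _ h1), ?_⟩
  funext z
  rw [hs]
  exact map_ofHom _ _ _ _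

theorem IsSmooth.zero : IsSmooth (0 : RawForm A B) := fun p => by
  have h : rep p (0 : RawForm A B) = fun _ => 0 := funext fun z => map_zero _
  rw [h]
  exact contDiffAt_const

theorem IsSmooth.add {α β : RawForm A B} (hα : IsSmooth α) (hβ : IsSmooth β) :
    IsSmooth (α + β) := fun p => by
  have h : rep p (α + β) = fun z => rep p α z + rep p β z := funext fun z => map_add _ _ _
  rw [h]
  exact (hα p).add (hβ p)

theorem IsSmooth.neg {α : RawForm A B} (hα : IsSmooth α) : IsSmooth (-α) := fun p => by
  have h : rep p (-α) = fun z => -rep p α z := funext fun z => map_neg _ _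
  rw [h]
  exact (hα p).neg

theorem IsSmooth.mul {α : RawForm B C} {β : RawForm A B} (hα : IsSmooth α) (hβ : IsSmooth β) :
    IsSmooth (fun x => mul (α x) (β x)) := fun p =>
  (contDiffAt_bilin (hα p) (hβ p) FormFiber.mul).congr_of_eventuallyEq (rep_mul p α β)

theorem IsSmooth.rankSign {α : RawForm A B} (hα : IsSmooth α) :
    IsSmooth (fun x => rankSign (α x)) := fun p => by
  rw [rep_rankSign]
  exact contDiffAt_lin (hα p) FormFiber.rankSign

theorem IsHolHom.isSmooth {f : ∀ x, A.E x →L[ℂ] B.E x} (hf : IsHolHom A B f) :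
    IsSmooth (fun x => ofHom (f x) : RawForm A B) := fun p => by
  obtain ⟨k, hk, h⟩ := rep_ofHom hf p
  rw [h]
  exact contDiffAt_ofHom hk

theorem dbar_add {α β : RawForm A B} (hα : IsSmooth α) (hβ : IsSmooth β) :
    dbar (α + β) = dbar α + dbar β := by
  funext x
  apply eq_of_toModel
  have h : rep x (α + β) = fun z => rep x α z + rep x β z := funext fun z => map_add _ _ _
  rw [toModel_dbar, h, dbarModel_add ((hα x).differentiableAt (by simp))
    ((hβ x).differentiableAt (by simp)), Pi.add_apply, map_add, toModel_dbar, toModel_dbar]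

theorem dbar_mul {α : RawForm B C} {β : RawForm A B} (hα : IsSmooth α) (hβ : IsSmooth β) (x : X) :
    dbar (fun x => mul (α x) (β x)) x =
      mul (dbar α x) (β x) + mul (rankSign (α x)) (dbar β x) := by
  apply eq_of_toModel
  rw [dbar_congr_of_rep (rep_mul x α β), dbarModel_mul ((hα x).differentiableAt (by simp))
    ((hβ x).differentiableAt (by simp)), map_add, toModel_mul (mem_dom x), toModel_mul (mem_dom x),
    toModel_dbar, toModel_dbar, rep_self, rep_self, toModel, toModel, map_rankSign]

theorem dbar_rankSign {α : RawForm A B} (hα : IsSmooth α) (x : X) :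
    dbar (fun x => rankSign (α x)) x = -rankSign (dbar α x) := by
  apply eq_of_toModel
  rw [toModel_dbar, rep_rankSign, dbarModel_rankSign ((hα x).differentiableAt (by simp)),
    ← toModel_dbar, map_neg]
  exact congrArg _ (map_rankSign _ _ _ _).symm

theorem IsHolHom.dbar {f : ∀ x, A.E x →L[ℂ] B.E x} (hf : IsHolHom A B f) (x : X) :
    dbar (fun x => ofHom (f x) : RawForm A B) x = 0 := by
  obtain ⟨k, hk, h⟩ := rep_ofHom hf x
  apply eq_of_toModel
  rw [toModel_dbar, h, dbarModel_ofHom (hk.differentiableAt (by simp)), map_zero]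

/-- The Dolbeault operator is local. -/
theorem dbar_eq_zero {α : RawForm A B} {x : X} (h : ∀ᶠ y in 𝓝 x, α y = 0) : dbar α x = 0 := by
  apply eq_of_toModel
  have hs : (chartAt V x).symm (chartAt V x x) = x := (chartAt V x).left_inv (mem_chart_source V x)
  have hc := (chartAt V x).continuousAt_symm ((chartAt V x).map_source (mem_chart_source V x))
  have h1 : rep x α =ᶠ[𝓝 (chartAt V x x)] fun _ => 0 := by
    have h2 := hc.eventually (hs.symm ▸ h)
    filter_upwards [h2] with z hz
    rw [rep, hz, map_zero]
  rw [dbar_congr_of_rep h1, map_zero]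
  simp [dbarModel, antiDeriv]

variable (V X) in
/-- The ring `O(X)` of holomorphic functions on `X`. -/
abbrev HolFun : Type _ := C^ω⟮𝓘(ℂ, V), X; 𝓘(ℂ, ℂ), ℂ⟯

theorem HolFun.contDiffAt (f : HolFun V X) (p : X) :
    ContDiffAt ℂ ω (fun z => f ((chartAt V p).symm z)) (chartAt V p p) := by
  have ht := (chartAt V p).map_source (mem_chart_source V p)
  have h1 : ContMDiffAt 𝓘(ℂ, V) 𝓘(ℂ, V) ω (chartAt V p).symm (chartAt V p p) :=
    contMDiffOn_chart_symm.contMDiffAt ((chartAt V p).open_target.mem_nhds ht)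
  exact contMDiffAt_iff_contDiffAt.1 (f.contMDiff.contMDiffAt.comp _ h1)

theorem rep_smul (f : HolFun V X) (p : X) (α : RawForm A B) :
    rep p (fun x => f x • α x) = fun z => mul (ofHom (f ((chartAt V p).symm z) • .id ℂ B.F))
      (rep p α z) := by
  funext z
  rw [rep, map_smul, map_smul, map_smul, LinearMap.smul_apply, FormFiber.one_mul]
  rfl

theorem contDiffAt_smul_id (f : HolFun V X) (p : X) :
    ContDiffAt ℂ ω (fun z => f ((chartAt V p).symm z) • ContinuousLinearMap.id ℂ B.F)
      (chartAt V p p) :=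
  (f.contDiffAt p).smul contDiffAt_const

theorem IsSmooth.smul {α : RawForm A B} (hα : IsSmooth α) (f : HolFun V X) :
    IsSmooth (fun x => f x • α x) := fun p => by
  rw [rep_smul]
  exact contDiffAt_bilin (contDiffAt_ofHom (contDiffAt_smul_id f p)) (hα p) FormFiber.mul

theorem dbar_smul {α : RawForm A B} (hα : IsSmooth α) (f : HolFun V X) (x : X) :
    dbar (fun x => f x • α x) x = f x • dbar α x := by
  apply eq_of_toModel
  have hs : (chartAt V x).symm (chartAt V x x) = x := (chartAt V x).left_inv (mem_chart_source V x)
  have hd := contDiffAt_smul_id (B := B) f x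
  rw [toModel_dbar, rep_smul, dbarModel_mul ((contDiffAt_ofHom hd).differentiableAt (by simp))
    ((hα x).differentiableAt (by simp)), dbarModel_ofHom (hd.differentiableAt (by simp)), hs,
    rankSign_ofHom, ← toModel_dbar, map_zero, LinearMap.zero_apply, zero_add, map_smul, map_smul,
    map_smul, LinearMap.smul_apply, FormFiber.one_mul]

variable (A B) in
/-- The group of smooth sections of `∧ T̄*X ⊗ Hom(A, B)`, i.e. of smooth forms of type `(0, *)` with
values in `Hom(A, B)`. -/
def Form : AddSubgroup (RawForm A B) where
  carrier := {α | IsSmooth α}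
  zero_mem' := IsSmooth.zero
  add_mem' := IsSmooth.add
  neg_mem' := IsSmooth.neg

instance : Module (HolFun V X) (Form A B) where
  smul f α := ⟨fun x => f x • α.1 x, α.2.smul f⟩
  one_smul α := Subtype.ext (funext fun x => one_smul ℂ (α.1 x))
  mul_smul f g α := Subtype.ext (funext fun x => mul_smul (f x) (g x) (α.1 x))
  smul_zero f := Subtype.ext (funext fun x => smul_zero (f x))
  smul_add f α β := Subtype.ext (funext fun x => smul_add (f x) (α.1 x) (β.1 x))
  add_smul f g α := Subtype.ext (funext fun x => add_smul (f x) (g x) (α.1 x))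
  zero_smul α := Subtype.ext (funext fun x => zero_smul ℂ (α.1 x))

theorem Form.ext {α β : Form A B} (h : ∀ x, α.1 x = β.1 x) : α = β := Subtype.ext (funext h)

theorem Form.add_apply (α β : Form A B) (x : X) : (α + β).1 x = α.1 x + β.1 x := rfl

theorem Form.neg_apply (α : Form A B) (x : X) : (-α).1 x = -α.1 x := rfl

theorem Form.sub_apply (α β : Form A B) (x : X) : (α - β).1 x = α.1 x - β.1 x := rfl

theorem Form.zero_apply (x : X) : (0 : Form A B).1 x = 0 := rfl

theorem Form.smul_apply (f : HolFun V X) (α : Form A B) (x : X) :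
    (f • α).1 x = f x • α.1 x := rfl

/-- The Dolbeault operator on smooth forms. -/
def Form.dbarLin : Form A B →ₗ[HolFun V X] Form A B where
  toFun α := ⟨dbar α.1, α.2.dbar⟩
  map_add' α β := Subtype.ext (dbar_add α.2 β.2)
  map_smul' f α := Form.ext fun x => dbar_smul α.2 f x

/-- The rank sign operator on smooth forms. -/
def Form.rankSignLin : Form A B →ₗ[HolFun V X] Form A B where
  toFun α := ⟨fun x => rankSign (α.1 x), α.2.rankSign⟩
  map_add' _ _ := Form.ext fun _ => map_add _ _ _
  map_smul' _ _ := Form.ext fun _ => map_smul _ _ _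

/-- The product of smooth forms, without signs. -/
def Form.mulLin : Form B C →ₗ[HolFun V X] Form A B →ₗ[HolFun V X] Form A C :=
  LinearMap.mk₂ (HolFun V X) (fun α β => ⟨fun x => mul (α.1 x) (β.1 x), α.2.mul β.2⟩)
    (fun _ _ _ => Form.ext fun _ => LinearMap.map_add₂ _ _ _ _)
    (fun _ _ _ => Form.ext fun _ => LinearMap.map_smul₂ _ _ _ _)
    (fun _ _ _ => Form.ext fun _ => map_add _ _ _)
    (fun _ _ _ => Form.ext fun _ => map_smul _ _ _)

/-- A holomorphic section of `Hom(A, B)`, as a smooth form. -/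
def Form.ofHolHom {f : ∀ x, A.E x →L[ℂ] B.E x} (hf : IsHolHom A B f) : Form A B :=
  ⟨fun x => ofHom (f x), hf.isSmooth⟩

theorem Form.dbarLin_mulLin (α : Form B C) (β : Form A B) :
    dbarLin (mulLin α β) = mulLin (dbarLin α) β + mulLin (rankSignLin α) (dbarLin β) :=
  Form.ext fun x => dbar_mul α.2 β.2 x

theorem Form.dbarLin_rankSignLin (α : Form A B) :
    dbarLin (rankSignLin α) = -rankSignLin (dbarLin α) :=
  Form.ext fun x => dbar_rankSign α.2 x

theorem Form.dbarLin_ofHolHom {f : ∀ x, A.E x →L[ℂ] B.E x} (hf : IsHolHom A B f) :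
    dbarLin (ofHolHom hf) = 0 :=
  Form.ext fun x => hf.dbar x

theorem Form.dbarLin_dbarLin (α : Form A B) : dbarLin (dbarLin α) = 0 :=
  Subtype.ext (dbar_dbar α.2)

end Forms
end LG

namespace LG

section SuperFiber

variable {T : Type*} [AddCommGroup T] [Module ℂ T] [TopologicalSpace T]
  {E : Type*} [AddCommGroup E] [Module ℂ E] [TopologicalSpace E] [IsTopologicalAddGroup E]
  [ContinuousSMul ℂ E]
  {G : Type*} [AddCommGroup G] [Module ℂ G] [TopologicalSpace G] [IsTopologicalAddGroup G]
  [ContinuousSMul ℂ G]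
  {K : Type*} [AddCommGroup K] [Module ℂ K] [TopologicalSpace K] [IsTopologicalAddGroup K]
  [ContinuousSMul ℂ K]
  {L : Type*} [AddCommGroup L] [Module ℂ L] [TopologicalSpace L] [IsTopologicalAddGroup L]
  [ContinuousSMul ℂ L]

namespace FormFiber

/-- The sign operator of the bundle grading, for parity involutions `γ` of `E` and `γ'` of `G`:
`ρ ⊗ f ↦ ρ ⊗ (γ' ∘ f ∘ γ)`, which is `(-1) ^ σ(f) • ρ ⊗ f` if `f` has parity `σ(f)`. -/
def bundleSign (γ' : G →L[ℂ] G) (γ : E →L[ℂ] E) : FormFiber T E G →ₗ[ℂ] FormFiber T E G :=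
  map (.id ℂ T) γ γ'

/-- The sign operator of the total grading: `ρ ⊗ f ↦ (-1) ^ (rk ρ + σ(f)) • ρ ⊗ f`. -/
def totalSign (γ' : G →L[ℂ] G) (γ : E →L[ℂ] E) : FormFiber T E G →ₗ[ℂ] FormFiber T E G :=
  rankSign ∘ₗ bundleSign γ' γ

/-- The composition `(ρ ⊗ f) ∘ (η ⊗ g) = (-1) ^ (σ(f) * rk η) • (ρ ∧ η) ⊗ (f ∘ g)`. The first
argument `x` is split into its parts of even and of odd parity `σ`. -/
def comp (γ'' : K →L[ℂ] K) (γ' : G →L[ℂ] G) (x : FormFiber T G K) (y : FormFiber T E G) :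
    FormFiber T E K :=
  mul ((2⁻¹ : ℂ) • (x + bundleSign γ'' γ' x)) y +
    mul ((2⁻¹ : ℂ) • (x - bundleSign γ'' γ' x)) (rankSign y)

/-- The defect differential, i.e. the graded commutator with odd maps `D` of `E` and `D'` of `G`:
`𝔡(ρ ⊗ f) = (-1) ^ rk ρ • ρ ⊗ (D' ∘ f) - (-1) ^ (rk ρ + σ(f)) • ρ ⊗ (f ∘ D)`. -/
def defect (γ' D' : G →L[ℂ] G) (γ D : E →L[ℂ] E) : FormFiber T E G →ₗ[ℂ] FormFiber T E G :=
  mul (ofHom D') ∘ₗ rankSign - mul.flip (ofHom D) ∘ₗ totalSign γ' γ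

theorem totalSign_apply (γ' : G →L[ℂ] G) (γ : E →L[ℂ] E) (x : FormFiber T E G) :
    totalSign γ' γ x = rankSign (bundleSign γ' γ x) := rfl

theorem defect_apply (γ' D' : G →L[ℂ] G) (γ D : E →L[ℂ] E) (x : FormFiber T E G) :
    defect γ' D' γ D x =
      mul (ofHom D') (rankSign x) - mul (rankSign (bundleSign γ' γ x)) (ofHom D) := rfl

theorem bundleSign_eq (γ' : G →L[ℂ] G) (γ : E →L[ℂ] E) (x : FormFiber T E G) :
    bundleSign γ' γ x = mul (ofHom γ') (mul x (ofHom γ)) := by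
  induction x using induction with
  | h0 => simp
  | ha x x' h h' => simp only [map_add, h, h', LinearMap.add_apply]
  | ht ρ f =>
    have h : ExteriorAlgebra.map (pullCovector (.id ℂ T)) = AlgHom.id ℂ (AntiExt T) :=
      ExteriorAlgebra.map_id
    rw [bundleSign, map_tmul, h, ofHom_eq, ofHom_eq, mul_tmul, mul_tmul, _root_.mul_one,
      _root_.one_mul]
    rfl

theorem bundleSign_rankSign (γ' : G →L[ℂ] G) (γ : E →L[ℂ] E) (x : FormFiber T E G) :
    bundleSign γ' γ (rankSign x) = rankSign (bundleSign γ' γ x) := map_rankSign _ _ _ _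

theorem bundleSign_ofHom (γ' : G →L[ℂ] G) (γ : E →L[ℂ] E) (f : E →L[ℂ] G) :
    bundleSign γ' γ (ofHom f : FormFiber T E G) = ofHom (γ'.comp (f.comp γ)) := map_ofHom _ _ _ _

theorem bundleSign_bundleSign {γ' : G →L[ℂ] G} {γ : E →L[ℂ] E} (h' : γ'.comp γ' = .id ℂ G)
    (h : γ.comp γ = .id ℂ E) (x : FormFiber T E G) :
    bundleSign γ' γ (bundleSign γ' γ x) = x := by
  rw [bundleSign, map_map, h, h']
  exact map_id x

theorem bundleSign_mul {γ'' : K →L[ℂ] K} {γ' : G →L[ℂ] G} {γ : E →L[ℂ] E}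
    (h' : γ'.comp γ' = .id ℂ G) (x : FormFiber T G K) (y : FormFiber T E G) :
    bundleSign γ'' γ (mul x y) = mul (bundleSign γ'' γ' x) (bundleSign γ' γ y) :=
  map_mul _ _ _ _ _ h' x y

variable {γ₄ : L →L[ℂ] L} {γ₃ : K →L[ℂ] K} {γ₂ : G →L[ℂ] G} {γ₁ : E →L[ℂ] E}
  {D₃ : K →L[ℂ] K} {D₂ : G →L[ℂ] G} {D₁ : E →L[ℂ] E}

/-- The composition of tensors of definite degrees. -/
theorem comp_tmul (ρ : AntiExt T) (f : G →L[ℂ] K) (η : AntiExt T) (g : E →L[ℂ] G) (s r : ℕ)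
    (hf : γ₃.comp (f.comp γ₂) = (-1 : ℂ) ^ s • f)
    (hη : CliffordAlgebra.involute η = (-1 : ℂ) ^ r • η) :
    comp γ₃ γ₂ (tmul ρ f) (tmul η g) = (-1 : ℂ) ^ (s * r) • tmul (ρ * η) (f.comp g) := by
  have h : ExteriorAlgebra.map (pullCovector (.id ℂ T)) = AlgHom.id ℂ (AntiExt T) :=
    ExteriorAlgebra.map_id
  have h1 : bundleSign γ₃ γ₂ (tmul ρ f) = (-1 : ℂ) ^ s • tmul ρ f := by
    rw [bundleSign, map_tmul, h, hf]
    exact TensorProduct.tmul_smul _ _ _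
  have h2 : (rankSign (tmul η g) : FormFiber T E G) = (-1 : ℂ) ^ r • tmul η g := by
    rw [rankSign_tmul, hη]
    exact (TensorProduct.smul_tmul' _ _ _).symm
  rw [comp, h1, h2]
  simp only [map_add, map_sub, map_smul, LinearMap.add_apply, LinearMap.sub_apply,
    LinearMap.smul_apply, mul_tmul, pow_mul]
  obtain hs | hs := neg_one_pow_eq_or ℂ s <;> rw [hs]
  · simp only [one_pow]; module
  · module

/-- The defect differential of tensors of definite degrees. -/
theorem defect_tmul (ρ : AntiExt T) (f : E →L[ℂ] G) (s r : ℕ)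
    (hf : γ₂.comp (f.comp γ₁) = (-1 : ℂ) ^ s • f)
    (hρ : CliffordAlgebra.involute ρ = (-1 : ℂ) ^ r • ρ) :
    defect γ₂ D₂ γ₁ D₁ (tmul ρ f) =
      (-1 : ℂ) ^ r • tmul ρ (D₂.comp f) - (-1 : ℂ) ^ (r + s) • tmul ρ (f.comp D₁) := by
  have h : ExteriorAlgebra.map (pullCovector (.id ℂ T)) = AlgHom.id ℂ (AntiExt T) :=
    ExteriorAlgebra.map_id
  have h1 : bundleSign γ₂ γ₁ (tmul ρ f) = (-1 : ℂ) ^ s • tmul ρ f := by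
    rw [bundleSign, map_tmul, h, hf]
    exact TensorProduct.tmul_smul _ _ _
  have h2 : (rankSign (tmul ρ f) : FormFiber T E G) = (-1 : ℂ) ^ r • tmul ρ f := by
    rw [rankSign_tmul, hρ]
    exact (TensorProduct.smul_tmul' _ _ _).symm
  rw [defect_apply, h1, map_smul, h2]
  simp only [map_smul, LinearMap.smul_apply, ofHom_eq, mul_tmul, _root_.mul_one, _root_.one_mul]
  rw [smul_smul, pow_add, _root_.mul_comm]

theorem rankSign_comp (x : FormFiber T G K) (y : FormFiber T E G) :
    rankSign (comp γ₃ γ₂ x y) = comp γ₃ γ₂ (rankSign x) (rankSign y) := by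
  simp only [comp, map_add, map_sub, map_smul, LinearMap.add_apply, LinearMap.sub_apply,
    LinearMap.smul_apply, rankSign_mul, rankSign_rankSign, bundleSign_rankSign]

theorem bundleSign_comp (h₃ : γ₃.comp γ₃ = .id ℂ K) (h₂ : γ₂.comp γ₂ = .id ℂ G)
    (x : FormFiber T G K) (y : FormFiber T E G) :
    bundleSign γ₃ γ₁ (comp γ₃ γ₂ x y) =
      comp γ₃ γ₂ (bundleSign γ₃ γ₂ x) (bundleSign γ₂ γ₁ y) := by
  simp only [comp, map_add, map_sub, map_smul, LinearMap.add_apply, LinearMap.sub_apply,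
    LinearMap.smul_apply, bundleSign_mul h₂, bundleSign_bundleSign h₃ h₂, bundleSign_rankSign]

theorem comp_assoc (h₄ : γ₄.comp γ₄ = .id ℂ L) (h₃ : γ₃.comp γ₃ = .id ℂ K)
    (x : FormFiber T K L) (y : FormFiber T G K) (z : FormFiber T E G) :
    comp γ₄ γ₂ (comp γ₄ γ₃ x y) z = comp γ₄ γ₃ x (comp γ₃ γ₂ y z) := by
  simp only [comp, map_add, map_sub, map_smul, LinearMap.add_apply, LinearMap.sub_apply,
    LinearMap.smul_apply, bundleSign_mul h₃, bundleSign_bundleSign h₄ h₃,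
    bundleSign_rankSign, rankSign_mul, rankSign_rankSign, mul_assoc]
  module

theorem defect_comp (h₃ : γ₃.comp γ₃ = .id ℂ K) (h₂ : γ₂.comp γ₂ = .id ℂ G)
    (hD₃ : γ₃.comp (D₃.comp γ₃) = -D₃) (hD₂ : γ₂.comp (D₂.comp γ₂) = -D₂)
    (x : FormFiber T G K) (y : FormFiber T E G) :
    defect γ₃ D₃ γ₁ D₁ (comp γ₃ γ₂ x y) =
      comp γ₃ γ₂ (defect γ₃ D₃ γ₂ D₂ x) y +
        comp γ₃ γ₂ (totalSign γ₃ γ₂ x) (defect γ₂ D₂ γ₁ D₁ y) := by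
  simp only [comp, defect_apply, totalSign_apply, map_add, map_sub, map_smul, map_neg,
    LinearMap.add_apply, LinearMap.sub_apply, LinearMap.neg_apply,
    LinearMap.smul_apply, bundleSign_mul h₂, bundleSign_mul h₃, bundleSign_bundleSign h₃ h₂,
    bundleSign_rankSign, bundleSign_ofHom, hD₃, hD₂, rankSign_mul, rankSign_rankSign,
    rankSign_ofHom, mul_assoc]
  module

theorem defect_defect (h₂ : γ₂.comp γ₂ = .id ℂ G) (h₁ : γ₁.comp γ₁ = .id ℂ E)
    (hD₂ : γ₂.comp (D₂.comp γ₂) = -D₂) (hD₁ : γ₁.comp (D₁.comp γ₁) = -D₁)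
    {c : ℂ} (hc₂ : D₂.comp D₂ = c • .id ℂ G) (hc₁ : D₁.comp D₁ = c • .id ℂ E)
    (x : FormFiber T E G) :
    defect γ₂ D₂ γ₁ D₁ (defect γ₂ D₂ γ₁ D₁ x) = 0 := by
  have h3 : mul (ofHom D₂) (mul (ofHom D₂) x) = c • x := by
    rw [← mul_assoc, ofHom_mul_ofHom, hc₂, map_smul, map_smul, LinearMap.smul_apply, one_mul]
  have h4 : mul (mul x (ofHom D₁)) (ofHom D₁) = c • x := by
    rw [mul_assoc, ofHom_mul_ofHom, hc₁, map_smul, map_smul, mul_one]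
  rw [mul_assoc] at h4
  simp only [defect_apply, map_sub, map_neg, LinearMap.neg_apply,
    bundleSign_mul h₂, bundleSign_mul h₁, bundleSign_bundleSign h₂ h₁, bundleSign_rankSign,
    bundleSign_ofHom, hD₂, hD₁, rankSign_mul, rankSign_rankSign, rankSign_ofHom, mul_assoc, h3, h4]
  abel

theorem bundleSign_defect (h₂ : γ₂.comp γ₂ = .id ℂ G) (h₁ : γ₁.comp γ₁ = .id ℂ E)
    (hD₂ : γ₂.comp (D₂.comp γ₂) = -D₂) (hD₁ : γ₁.comp (D₁.comp γ₁) = -D₁) (x : FormFiber T E G) :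
    bundleSign γ₂ γ₁ (defect γ₂ D₂ γ₁ D₁ x) = -defect γ₂ D₂ γ₁ D₁ (bundleSign γ₂ γ₁ x) := by
  simp only [defect_apply, map_sub, map_neg, LinearMap.neg_apply,
    bundleSign_mul h₂, bundleSign_mul h₁, bundleSign_rankSign, bundleSign_bundleSign h₂ h₁,
    bundleSign_ofHom, hD₂, hD₁]
  abel

theorem rankSign_defect (x : FormFiber T E G) :
    rankSign (defect γ₂ D₂ γ₁ D₁ x) = defect γ₂ D₂ γ₁ D₁ (rankSign x) := by
  simp only [defect_apply, map_sub, rankSign_mul, rankSign_ofHom, bundleSign_rankSign]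

end FormFiber
end SuperFiber
end LG

namespace LG

section DG

set_option linter.checkUnivs false

universe r o h o' h'

/-- A `ℤ/2`-graded `R`-linear dg-category, with associative composition but without identity
morphisms as part of the data. -/
structure DGCategory (R : Type r) [CommRing R] where
  /-- the objects -/
  Obj : Type o
  /-- the modules of morphisms -/
  Hom : Obj → Obj → Type h
  [addCommGroup : ∀ a b, AddCommGroup (Hom a b)]
  [module : ∀ a b, Module R (Hom a b)]
  /-- the homogeneous morphisms of a given degree -/
  deg : ∀ a b, ZMod 2 → Submodule R (Hom a b)
  isCompl_deg : ∀ a b, IsCompl (deg a b 0) (deg a b 1)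
  /-- the composition `(f, g) ↦ f ∘ g` -/
  comp : ∀ a b c, Hom b c →ₗ[R] Hom a b →ₗ[R] Hom a c
  /-- the differential -/
  d : ∀ a b, Hom a b →ₗ[R] Hom a b
  comp_mem_deg : ∀ a b c i j f g, f ∈ deg b c i → g ∈ deg a b j → comp a b c f g ∈ deg a c (i + j)
  comp_assoc : ∀ a b c e f g k,
    comp a b e (comp b c e f g) k = comp a c e f (comp a b c g k)
  d_mem_deg : ∀ a b i f, f ∈ deg a b i → d a b f ∈ deg a b (i + 1)
  d_d : ∀ a b f, d a b (d a b f) = 0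
  leibniz : ∀ a b c i f g, f ∈ deg b c i →
    d a c (comp a b c f g) = comp a b c (d b c f) g + ((-1 : ℤˣ) ^ i) • comp a b c f (d a b g)

attribute [instance] DGCategory.addCommGroup DGCategory.module

variable {R : Type r} [CommRing R]

namespace DGCategory

variable (𝒯 : DGCategory.{r, o, h} R)

/-- The category has identity morphisms, closed and of degree zero. -/
def IsUnital : Prop :=
  ∀ a, ∃ e ∈ 𝒯.deg a a 0, 𝒯.d a a e = 0 ∧ (∀ b f, 𝒯.comp b a a e f = f) ∧
    ∀ b f, 𝒯.comp a a b f e = f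

/-- The cohomology of the complex of morphisms from `a` to `b`. -/
abbrev Coh (a b : 𝒯.Obj) : Type _ :=
  LinearMap.ker (𝒯.d a b) ⧸ (LinearMap.range (𝒯.d a b)).submoduleOf (LinearMap.ker (𝒯.d a b))

/-- The closed endomorphism `e` of `a` represents an identity morphism in the cohomology
category. -/
def IsCohId (a : 𝒯.Obj) (e : 𝒯.Hom a a) : Prop :=
  (∀ b f, 𝒯.d b a f = 0 → ∃ g, 𝒯.comp b a a e f - f = 𝒯.d b a g) ∧
    ∀ b f, 𝒯.d a b f = 0 → ∃ g, 𝒯.comp a a b f e - f = 𝒯.d a b g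

/-- The objects `a` and `b` are isomorphic in the degree zero cohomology category. -/
def CohIso (a b : 𝒯.Obj) : Prop :=
  ∃ f ∈ 𝒯.deg a b 0, ∃ g ∈ 𝒯.deg b a 0, 𝒯.d a b f = 0 ∧ 𝒯.d b a g = 0 ∧
    𝒯.IsCohId a (𝒯.comp a b a g f) ∧ 𝒯.IsCohId b (𝒯.comp b a b f g)

end DGCategory

/-- A functor of `ℤ/2`-graded `R`-linear dg-categories. -/
structure DGFunctor (𝒮 : DGCategory.{r, o, h} R) (𝒯 : DGCategory.{r, o', h'} R) where
  /-- the map on objects -/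
  obj : 𝒮.Obj → 𝒯.Obj
  /-- the maps on morphisms -/
  map : ∀ a b, 𝒮.Hom a b →ₗ[R] 𝒯.Hom (obj a) (obj b)
  map_mem_deg : ∀ a b i f, f ∈ 𝒮.deg a b i → map a b f ∈ 𝒯.deg (obj a) (obj b) i
  map_d : ∀ a b f, map a b (𝒮.d a b f) = 𝒯.d (obj a) (obj b) (map a b f)
  map_comp : ∀ a b c f g, map a c (𝒮.comp a b c f g) =
    𝒯.comp (obj a) (obj b) (obj c) (map b c f) (map a b g)

namespace DGFunctor

variable {𝒮 : DGCategory.{r, o, h} R} {𝒯 : DGCategory.{r, o', h'} R} (Φ : DGFunctor 𝒮 𝒯)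

/-- The map induced on closed morphisms. -/
def mapKer (a b : 𝒮.Obj) :
    LinearMap.ker (𝒮.d a b) →ₗ[R] LinearMap.ker (𝒯.d (Φ.obj a) (Φ.obj b)) :=
  (Φ.map a b).restrict fun f hf => by
    rw [LinearMap.mem_ker] at hf ⊢
    rw [← Φ.map_d, hf, map_zero]

/-- The map induced on cohomology. -/
def mapCoh (a b : 𝒮.Obj) : 𝒮.Coh a b →ₗ[R] 𝒯.Coh (Φ.obj a) (Φ.obj b) :=
  Submodule.mapQ _ _ (Φ.mapKer a b) (by
    rintro ⟨f, hf⟩ ⟨g, hg⟩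
    exact ⟨Φ.map a b g, by rw [← Φ.map_d]; exact congrArg _ hg⟩)

/-- A functor is a quasi-equivalence if it induces isomorphisms on the cohomology of the complexes
of morphisms and is essentially surjective on degree zero cohomology categories. -/
def IsQuasiEquivalence : Prop :=
  (∀ a b, Function.Bijective (Φ.mapCoh a b)) ∧ ∀ t, ∃ s, 𝒯.CohIso (Φ.obj s) t

/-- The map `𝒮(a, b) → 𝒯(Φ a, Φ b)` is a homotopy equivalence of complexes of `R`-modules, with
`R`-linear homotopy inverse `p` (even and compatible with the differentials) and `R`-linear odd
homotopies `h` and `h'`, where `h'` is the restriction of `h`. -/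
def IsHomotopyEquivalence (a b : 𝒮.Obj) : Prop :=
  ∃ (p : 𝒯.Hom (Φ.obj a) (Φ.obj b) →ₗ[R] 𝒮.Hom a b)
    (h : 𝒯.Hom (Φ.obj a) (Φ.obj b) →ₗ[R] 𝒯.Hom (Φ.obj a) (Φ.obj b))
    (h' : 𝒮.Hom a b →ₗ[R] 𝒮.Hom a b),
    (∀ i, ∀ f ∈ 𝒯.deg (Φ.obj a) (Φ.obj b) i, p f ∈ 𝒮.deg a b i) ∧
    (∀ i, ∀ f ∈ 𝒯.deg (Φ.obj a) (Φ.obj b) i, h f ∈ 𝒯.deg (Φ.obj a) (Φ.obj b) (i + 1)) ∧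
    (∀ i, ∀ f ∈ 𝒮.deg a b i, h' f ∈ 𝒮.deg a b (i + 1)) ∧
    (∀ f, p (𝒯.d _ _ f) = 𝒮.d a b (p f)) ∧
    (∀ f, f - Φ.map a b (p f) = 𝒯.d _ _ (h f) + h (𝒯.d _ _ f)) ∧
    (∀ f, f - p (Φ.map a b f) = 𝒮.d a b (h' f) + h' (𝒮.d a b f)) ∧
    ∀ f, Φ.map a b (h' f) = h (Φ.map a b f)

end DGFunctor
end DG
end LG

namespace LG

section Factorizations

universe u v w

variable (V : Type u) [NormedAddCommGroup V] [NormedSpace ℂ V] [FiniteDimensional ℂ V]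
  (X : Type v) [TopologicalSpace X] [ChartedSpace V X] [IsManifold 𝓘(ℂ, V) ω X]

/-- A holomorphic vector superbundle `E = E⁰ ⊕ E¹`. The decomposition into holomorphic subbundles is
given by the holomorphic involution `γ` of `E` that is `1` on `E⁰` and `-1` on `E¹`; so `E⁰` and
`E¹` are the kernels of `γ - 1` and `γ + 1`, and `f : A → B` is even if `γ ∘ f ∘ γ = f` and
odd if `γ ∘ f ∘ γ = -f`. -/
structure HolSuperbundle extends HolBundle.{u, v, w} V X where
  /-- the parity involution -/
  γ : ∀ x, E x →L[ℂ] E x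
  γ_comp_γ : ∀ x, (γ x).comp (γ x) = .id ℂ (E x)
  isHolHom_γ : IsHolHom toHolBundle toHolBundle γ

variable {V X}

/-- A holomorphic factorization of `W`: a holomorphic superbundle with an odd holomorphic
endomorphism `D` such that `D ∘ D = W • id`. -/
structure HolFactorization (W : HolFun V X) extends HolSuperbundle.{u, v, w} V X where
  /-- the endomorphism -/
  D : ∀ x, E x →L[ℂ] E x
  isHolHom_D : IsHolHom toHolBundle toHolBundle D
  D_odd : ∀ x, (γ x).comp ((D x).comp (γ x)) = -D x
  D_comp_D : ∀ x, (D x).comp (D x) = W x • .id ℂ (E x)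

/-- The critical set of `W`, i.e. the zero set of `∂W`. -/
def critSet (W : HolFun V X) : Set X := {x | mfderiv 𝓘(ℂ, V) 𝓘(ℂ, ℂ) W x = 0}

variable {W : HolFun V X}

namespace HolFactorization

/-- The module `A(X, Hom(E₁, E₂))` of morphisms `a → b`: smooth sections of
`∧ T̄*X ⊗ Hom(E₁, E₂)`. -/
abbrev Mor (a b : HolFactorization.{u, v, w} W) : AddSubgroup (RawForm a.toHolBundle b.toHolBundle) :=
  Form a.toHolBundle b.toHolBundle

variable {a b c e : HolFactorization.{u, v, w} W}

open FormFiber Form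

/-- The sign operator of the bundle grading on forms. -/
def bundleSignLin (a b : HolFactorization.{u, v, w} W) : Mor a b →ₗ[HolFun V X] Mor a b where
  toFun α := ⟨fun x => bundleSign (b.γ x) (a.γ x) (α.1 x), by
    simp only [bundleSign_eq]
    exact b.isHolHom_γ.isSmooth.mul (α.2.mul a.isHolHom_γ.isSmooth)⟩
  map_add' _ _ := Form.ext fun _ => map_add _ _ _
  map_smul' _ _ := Form.ext fun _ => map_smul _ _ _

theorem bundleSignLin_eq (α : Mor a b) : bundleSignLin a b α =
    mulLin (ofHolHom b.isHolHom_γ) (mulLin α (ofHolHom a.isHolHom_γ)) :=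
  Form.ext fun _ => bundleSign_eq _ _ _

/-- The sign operator of the total grading on forms. -/
def totalSignLin (a b : HolFactorization.{u, v, w} W) : Mor a b →ₗ[HolFun V X] Mor a b where
  toFun α := ⟨fun x => totalSign (b.γ x) (a.γ x) (α.1 x), (bundleSignLin a b α).2.rankSign⟩
  map_add' _ _ := Form.ext fun _ => map_add _ _ _
  map_smul' _ _ := Form.ext fun _ => map_smul _ _ _

theorem totalSignLin_eq (α : Mor a b) :
    totalSignLin a b α = rankSignLin (bundleSignLin a b α) := rfl

/-- The forms of degree `i ∈ ℤ/2` with respect to the total grading. -/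
def degree (a b : HolFactorization.{u, v, w} W) (i : ZMod 2) : Submodule (HolFun V X) (Mor a b) where
  carrier := {α | totalSignLin a b α = ((-1 : ℤˣ) ^ i) • α}
  zero_mem' := by
    change totalSignLin a b 0 = _
    rw [map_zero, smul_zero]
  add_mem' {α β} h k := by
    change totalSignLin a b (α + β) = _
    rw [map_add, smul_add]
    exact congrArg₂ _ h k
  smul_mem' f α h := by
    change totalSignLin a b (f • α) = _
    rw [map_smul, smul_comm]
    exact congrArg _ h

theorem mem_degree {i : ZMod 2} {α : Mor a b} :
    α ∈ degree a b i ↔ totalSignLin a b α = ((-1 : ℤˣ) ^ i) • α := Iff.rfl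

/-- The constant function `1/2`. -/
def half : HolFun V X := ContMDiffMap.const (2⁻¹ : ℂ)

theorem half_smul (α : Mor a b) : (half : HolFun V X) • (α + α) = α :=
  Form.ext fun x => by
    change (2⁻¹ : ℂ) • (α.1 x + α.1 x) = α.1 x
    module

/-- The composition of forms. -/
def comp (a b c : HolFactorization.{u, v, w} W) :
    Mor b c →ₗ[HolFun V X] Mor a b →ₗ[HolFun V X] Mor a c :=
  LinearMap.mk₂ (HolFun V X)
    (fun α β => ⟨fun x => FormFiber.comp (c.γ x) (b.γ x) (α.1 x) (β.1 x),
      (mulLin ((half : HolFun V X) • (α + bundleSignLin b c α)) β +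
        mulLin ((half : HolFun V X) • (α - bundleSignLin b c α)) (rankSignLin β)).2⟩)
    (fun _ _ _ => Form.ext fun _ => by
      simp only [FormFiber.comp, map_add, map_sub, map_smul, LinearMap.add_apply,
        LinearMap.sub_apply, LinearMap.smul_apply, Form.add_apply]
      module)
    (fun _ _ _ => Form.ext fun _ => by
      simp only [FormFiber.comp, map_add, map_sub, map_smul, LinearMap.add_apply,
        LinearMap.sub_apply, LinearMap.smul_apply, Form.smul_apply]
      module)
    (fun _ _ _ => Form.ext fun _ => by
      simp only [FormFiber.comp, map_add, Form.add_apply]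
      module)
    (fun _ _ _ => Form.ext fun _ => by
      simp only [FormFiber.comp, map_smul, Form.smul_apply]
      module)

theorem comp_apply (α : Mor b c) (β : Mor a b) (x : X) :
    (comp a b c α β).1 x = FormFiber.comp (c.γ x) (b.γ x) (α.1 x) (β.1 x) := rfl

theorem comp_eq (α : Mor b c) (β : Mor a b) : comp a b c α β =
    mulLin ((half : HolFun V X) • (α + bundleSignLin b c α)) β +
      mulLin ((half : HolFun V X) • (α - bundleSignLin b c α)) (rankSignLin β) := rfl

/-- The defect differential on forms. -/
def defect (a b : HolFactorization.{u, v, w} W) : Mor a b →ₗ[HolFun V X] Mor a b where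
  toFun α := ⟨fun x => FormFiber.defect (b.γ x) (b.D x) (a.γ x) (a.D x) (α.1 x),
    (mulLin (ofHolHom b.isHolHom_D) (rankSignLin α) -
      mulLin (totalSignLin a b α) (ofHolHom a.isHolHom_D)).2⟩
  map_add' _ _ := Form.ext fun _ => map_add _ _ _
  map_smul' _ _ := Form.ext fun _ => map_smul _ _ _

theorem defect_eq (α : Mor a b) : defect a b α =
    mulLin (ofHolHom b.isHolHom_D) (rankSignLin α) -
      mulLin (totalSignLin a b α) (ofHolHom a.isHolHom_D) := rfl

/-- The twisted differential `δ = ∂̄ + 𝔡`. -/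
def delta (a b : HolFactorization.{u, v, w} W) : Mor a b →ₗ[HolFun V X] Mor a b :=
  dbarLin + defect a b

theorem delta_eq (α : Mor a b) : delta a b α = dbarLin α + defect a b α := rfl

theorem dbarLin_bundleSignLin (α : Mor a b) :
    dbarLin (bundleSignLin a b α) = bundleSignLin a b (dbarLin α) := by
  rw [bundleSignLin_eq, bundleSignLin_eq, dbarLin_mulLin, dbarLin_mulLin, dbarLin_ofHolHom,
    dbarLin_ofHolHom, map_zero, map_zero, LinearMap.zero_apply, zero_add, add_zero]
  congr 1
  exact congrArg mulLin (Form.ext fun _ => rankSign_ofHom _)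

theorem totalSignLin_dbarLin (α : Mor a b) :
    totalSignLin a b (dbarLin α) = -dbarLin (totalSignLin a b α) := by
  rw [totalSignLin_eq, totalSignLin_eq, dbarLin_rankSignLin, dbarLin_bundleSignLin, neg_neg]

theorem totalSignLin_defect (α : Mor a b) :
    totalSignLin a b (defect a b α) = -defect a b (totalSignLin a b α) :=
  Form.ext fun x => by
    change rankSign (bundleSign _ _ (FormFiber.defect _ _ _ _ _)) =
      -FormFiber.defect _ _ _ _ (rankSign (bundleSign _ _ _))
    rw [bundleSign_defect (b.γ_comp_γ x) (a.γ_comp_γ x) (b.D_odd x) (a.D_odd x), map_neg,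
      rankSign_defect]

theorem totalSignLin_delta (α : Mor a b) :
    totalSignLin a b (delta a b α) = -delta a b (totalSignLin a b α) := by
  rw [delta_eq, delta_eq, map_add, totalSignLin_dbarLin, totalSignLin_defect, neg_add]

theorem totalSignLin_totalSignLin (α : Mor a b) :
    totalSignLin a b (totalSignLin a b α) = α :=
  Form.ext fun x => by
    change rankSign (bundleSign _ _ (rankSign (bundleSign _ _ _))) = _
    rw [bundleSign_rankSign, rankSign_rankSign,
      bundleSign_bundleSign (b.γ_comp_γ x) (a.γ_comp_γ x)]

theorem totalSignLin_comp (α : Mor b c) (β : Mor a b) :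
    totalSignLin a c (comp a b c α β) =
      comp a b c (totalSignLin b c α) (totalSignLin a b β) :=
  Form.ext fun x => by
    change rankSign (bundleSign _ _ (FormFiber.comp _ _ _ _)) =
      FormFiber.comp _ _ (rankSign (bundleSign _ _ _)) (rankSign (bundleSign _ _ _))
    rw [bundleSign_comp (c.γ_comp_γ x) (b.γ_comp_γ x), rankSign_comp]

theorem delta_delta (α : Mor a b) : delta a b (delta a b α) = 0 := by
  have h1 : dbarLin (defect a b α) = -defect a b (dbarLin α) := by
    rw [defect_eq, defect_eq, map_sub, dbarLin_mulLin, dbarLin_mulLin, dbarLin_ofHolHom,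
      dbarLin_ofHolHom, totalSignLin_dbarLin, dbarLin_rankSignLin, map_zero, map_zero,
      LinearMap.zero_apply, map_neg, map_neg, LinearMap.neg_apply,
      show rankSignLin (ofHolHom b.isHolHom_D) = ofHolHom b.isHolHom_D from
        Form.ext fun _ => rankSign_ofHom _]
    abel
  have h2 : defect a b (defect a b α) = 0 := Form.ext fun x =>
    FormFiber.defect_defect (b.γ_comp_γ x) (a.γ_comp_γ x) (b.D_odd x) (a.D_odd x)
      (b.D_comp_D x) (a.D_comp_D x) _
  rw [delta_eq, delta_eq, map_add, map_add, dbarLin_dbarLin, h1, h2]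
  abel

theorem delta_comp (α : Mor b c) (β : Mor a b) :
    delta a c (comp a b c α β) =
      comp a b c (delta b c α) β + comp a b c (totalSignLin b c α) (delta a b β) := by
  have h1 : defect a c (comp a b c α β) =
      comp a b c (defect b c α) β + comp a b c (totalSignLin b c α) (defect a b β) :=
    Form.ext fun x => FormFiber.defect_comp (c.γ_comp_γ x) (b.γ_comp_γ x) (c.D_odd x)
      (b.D_odd x) _ _
  have hb : ∀ α : Mor b c, bundleSignLin b c (bundleSignLin b c α) = α := fun α =>
    Form.ext fun x => bundleSign_bundleSign (c.γ_comp_γ x) (b.γ_comp_γ x) _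
  have hr : ∀ α : Mor b c, bundleSignLin b c (rankSignLin α) = rankSignLin (bundleSignLin b c α) :=
    fun α => Form.ext fun x => bundleSign_rankSign _ _ _
  have h2 : dbarLin (comp a b c α β) =
      comp a b c (dbarLin α) β + comp a b c (totalSignLin b c α) (dbarLin β) := by
    simp only [comp_eq, totalSignLin_eq, map_add, map_sub, map_smul, map_neg, dbarLin_mulLin,
      dbarLin_rankSignLin, dbarLin_bundleSignLin, hr, hb, LinearMap.add_apply, LinearMap.sub_apply,
      LinearMap.smul_apply]
    module
  rw [delta_eq, delta_eq, delta_eq, h1, h2, map_add, map_add, LinearMap.add_apply]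
  abel

theorem comp_assoc (α : Mor c e) (β : Mor b c) (η : Mor a b) :
    comp a b e (comp b c e α β) η = comp a c e α (comp a b c β η) :=
  Form.ext fun x => FormFiber.comp_assoc (e.γ_comp_γ x) (c.γ_comp_γ x) _ _ _

theorem comp_mem_degree {i j : ZMod 2} {α : Mor b c} {β : Mor a b} (hα : α ∈ degree b c i)
    (hβ : β ∈ degree a b j) : comp a b c α β ∈ degree a c (i + j) := by
  rw [mem_degree] at *
  rw [totalSignLin_comp, hα, hβ, uzpow_add, mul_smul]
  obtain hi | hi := Int.units_eq_one_or ((-1 : ℤˣ) ^ i) <;>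
  obtain hj | hj := Int.units_eq_one_or ((-1 : ℤˣ) ^ j) <;> simp [hi, hj]

theorem delta_mem_degree {i : ZMod 2} {α : Mor a b} (hα : α ∈ degree a b i) :
    delta a b α ∈ degree a b (i + 1) := by
  rw [mem_degree] at *
  rw [totalSignLin_delta, hα, uzpow_add, mul_smul]
  obtain hi | hi := Int.units_eq_one_or ((-1 : ℤˣ) ^ i) <;> simp [hi]

theorem leibniz {i : ZMod 2} {α : Mor b c} (hα : α ∈ degree b c i) (β : Mor a b) :
    delta a c (comp a b c α β) =
      comp a b c (delta b c α) β + ((-1 : ℤˣ) ^ i) • comp a b c α (delta a b β) := by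
  rw [mem_degree] at hα
  rw [delta_comp, hα]
  obtain hi | hi := Int.units_eq_one_or ((-1 : ℤˣ) ^ i) <;> simp [hi]

theorem eq_zero_of_mem {α : Mor a b} (h0 : α ∈ degree a b 0) (h1 : α ∈ degree a b 1) : α = 0 := by
  rw [mem_degree] at h0 h1
  rw [h0, uzpow_zero, uzpow_one, one_smul, Units.neg_smul, one_smul] at h1
  rw [← half_smul α]
  nth_rw 1 [h1]
  rw [neg_add_cancel, smul_zero]

theorem add_mem_degree (α : Mor a b) :
    (half : HolFun V X) • (α + totalSignLin a b α) ∈ degree a b 0 := by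
  rw [mem_degree, map_smul, map_add, totalSignLin_totalSignLin, uzpow_zero, one_smul, add_comm]

theorem sub_mem_degree (α : Mor a b) :
    (half : HolFun V X) • (α - totalSignLin a b α) ∈ degree a b 1 := by
  rw [mem_degree, map_smul, map_sub, totalSignLin_totalSignLin, uzpow_one, Units.neg_smul, one_smul,
    ← smul_neg, neg_sub]

theorem add_sub_degree (α : Mor a b) : (half : HolFun V X) • (α + totalSignLin a b α) +
    (half : HolFun V X) • (α - totalSignLin a b α) = α := by
  rw [← smul_add, add_add_sub_cancel, half_smul]

theorem isCompl_degree (a b : HolFactorization.{u, v, w} W) :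
    IsCompl (degree a b 0) (degree a b 1) :=
  ⟨Submodule.disjoint_def.2 fun _ => eq_zero_of_mem, Submodule.codisjoint_iff_exists_add_eq.2
    fun α => ⟨_, _, add_mem_degree α, sub_mem_degree α, add_sub_degree α⟩⟩

/-- The compactly supported morphisms. -/
def compactMor (a b : HolFactorization.{u, v, w} W) : Submodule (HolFun V X) (Mor a b) where
  carrier := {α | IsCompact (closure {x | α.1 x ≠ 0})}
  zero_mem' := by simp
  add_mem' {α β} hα hβ := by
    refine (hα.union hβ).of_isClosed_subset isClosed_closure ?_
    rw [← closure_union]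
    refine closure_mono fun x hx => ?_
    by_contra! h
    simp only [mem_union, not_or, mem_ofPred_eq, not_not] at h
    exact hx (by rw [Form.add_apply, h.1, h.2, add_zero])
  smul_mem' f α hα := by
    refine hα.of_isClosed_subset isClosed_closure (closure_mono fun x hx h => hx ?_)
    rw [Form.smul_apply, h, smul_zero]

theorem compactMor_of_subset {α : Mor a b} {a' b' : HolFactorization.{u, v, w} W} {β : Mor a' b'}
    (hα : α ∈ compactMor a b) (h : ∀ x, α.1 x = 0 → β.1 x = 0) : β ∈ compactMor a' b' :=
  IsCompact.of_isClosed_subset hα isClosed_closure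
    (closure_mono fun x hx h' => hx (h x h'))

theorem comp_mem_compactMor {α : Mor b c} (hα : α ∈ compactMor b c) (β : Mor a b) :
    comp a b c α β ∈ compactMor a c :=
  compactMor_of_subset hα fun x hx => by
    rw [comp_apply, hx]
    simp [FormFiber.comp]

theorem totalSignLin_mem_compactMor {α : Mor a b} (hα : α ∈ compactMor a b) :
    totalSignLin a b α ∈ compactMor a b :=
  compactMor_of_subset hα fun x hx => by
    change totalSign _ _ (α.1 x) = 0
    rw [hx, map_zero]

theorem delta_mem_compactMor {α : Mor a b} (hα : α ∈ compactMor a b) :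
    delta a b α ∈ compactMor a b := by
  refine IsCompact.of_isClosed_subset hα isClosed_closure
    (closure_minimal (fun x hx => ?_) isClosed_closure)
  by_contra h
  have h1 : ∀ᶠ y in 𝓝 x, α.1 y = 0 := by
    filter_upwards [isClosed_closure.isOpen_compl.mem_nhds h] with y hy
    by_contra h2
    exact hy (subset_closure h2)
  refine hx ?_
  change dbar α.1 x + FormFiber.defect _ _ _ _ (α.1 x) = 0
  rw [dbar_eq_zero h1, h1.self_of_nhds, map_zero, add_zero]

theorem isCompl_degree_compactMor (a b : HolFactorization.{u, v, w} W) :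
    IsCompl ((degree a b 0).submoduleOf (compactMor a b))
      ((degree a b 1).submoduleOf (compactMor a b)) :=
  ⟨Submodule.disjoint_def.2 fun _ h0 h1 => Subtype.ext (eq_zero_of_mem h0 h1),
    Submodule.codisjoint_iff_exists_add_eq.2 fun α =>
      have h := totalSignLin_mem_compactMor α.2
      ⟨⟨_, Submodule.smul_mem _ half (add_mem α.2 h)⟩, ⟨_, Submodule.smul_mem _ half (sub_mem α.2 h)⟩,
        add_mem_degree α.1, sub_mem_degree α.1, Subtype.ext (add_sub_degree α.1)⟩⟩

/-- The composition of compactly supported forms. -/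
def compactComp (a b c : HolFactorization.{u, v, w} W) :
    compactMor b c →ₗ[HolFun V X] compactMor a b →ₗ[HolFun V X] compactMor a c :=
  LinearMap.mk₂ (HolFun V X) (fun α β => ⟨comp a b c α.1 β.1, comp_mem_compactMor α.2 β.1⟩)
    (fun _ _ _ => Subtype.ext (LinearMap.map_add₂ _ _ _ _))
    (fun _ _ _ => Subtype.ext (LinearMap.map_smul₂ _ _ _ _))
    (fun _ _ _ => Subtype.ext (map_add _ _ _)) (fun _ _ _ => Subtype.ext (map_smul _ _ _))

/-- The twisted differential of compactly supported forms. -/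
def compactDelta (a b : HolFactorization.{u, v, w} W) :
    compactMor a b →ₗ[HolFun V X] compactMor a b :=
  (delta a b).restrict fun _ => delta_mem_compactMor

theorem compact_leibniz {i : ZMod 2} {α : compactMor b c}
    (hα : α ∈ (degree b c i).submoduleOf (compactMor b c)) (β : compactMor a b) :
    compactDelta a c (compactComp a b c α β) = compactComp a b c (compactDelta b c α) β +
      ((-1 : ℤˣ) ^ i) • compactComp a b c α (compactDelta a b β) := by
  have h := leibniz (a := a) hα β.1
  have hs : ∀ (s : ℤˣ) (x : compactMor a c), (s • x).1 = s • x.1 := fun s x => by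
    obtain rfl | rfl := Int.units_eq_one_or s
    · rw [one_smul, one_smul]
    · rw [Units.neg_smul, one_smul, Units.neg_smul, one_smul]
      rfl
  refine Subtype.ext (h.trans ?_)
  exact congrArg₂ (· + ·) rfl (hs ((-1) ^ i) (compactComp a b c α (compactDelta a b β))).symm

end HolFactorization

open HolFactorization

/-- The twisted Dolbeault category of holomorphic factorizations `DF(X, W)`. -/
def DF (W : HolFun V X) : DGCategory.{v, max v (w + 1), max u v w} (HolFun V X) where
  Obj := HolFactorization.{u, v, w} W
  Hom a b := Mor a b
  deg := degree
  isCompl_deg := isCompl_degree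
  comp := comp
  d := delta
  comp_mem_deg _ _ _ _ _ _ _ := comp_mem_degree
  comp_assoc _ _ _ _ := HolFactorization.comp_assoc
  d_mem_deg _ _ _ _ := delta_mem_degree
  d_d _ _ := delta_delta
  leibniz _ _ _ _ _ g hf := leibniz hf g

theorem isHolHom_id (A : HolBundle.{u, v, w} V X) : IsHolHom A A fun x => .id ℂ (A.E x) := by
  intro p
  refine (contMDiffAt_hom_bundle _).2 ⟨contMDiffAt_id, ?_⟩
  refine (contMDiffAt_const (c := ContinuousLinearMap.id ℂ A.F)).congr_of_eventuallyEq ?_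
  filter_upwards [(trivializationAt A.F A.E p).open_baseSet.mem_nhds
    (FiberBundle.mem_baseSet_trivializationAt' p)] with x hx
  ext v
  exact Trivialization.continuousLinearMapAt_symmL _ hx v

open FormFiber in
/-- The category `DF(X, W)` is unital. -/
theorem isUnital_DF (W : HolFun V X) : (DF.{u, v, w} W).IsUnital := by
  intro a
  refine ⟨Form.ofHolHom (isHolHom_id a.toHolBundle), Form.ext fun x => ?_, Form.ext fun x => ?_,
    fun b f => Form.ext fun x => ?_, fun b f => Form.ext fun x => ?_⟩
  · have h : ((-1 : ℤˣ) ^ (0 : ZMod 2)) = 1 := uzpow_zero _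
    rw [h, one_smul]
    change rankSign (bundleSign _ _ (ofHom _)) = ofHom _
    rw [bundleSign_ofHom, rankSign_ofHom, ContinuousLinearMap.id_comp, a.γ_comp_γ]
  · change dbar (fun x => ofHom _) x + FormFiber.defect _ _ _ _ (ofHom _) = 0
    rw [(isHolHom_id a.toHolBundle).dbar, FormFiber.defect_apply, bundleSign_ofHom,
      ContinuousLinearMap.id_comp, a.γ_comp_γ, rankSign_ofHom, FormFiber.one_mul,
      FormFiber.mul_one, sub_self, add_zero]
  · change FormFiber.comp _ _ (ofHom _) (f.1 x) = f.1 x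
    rw [FormFiber.comp, bundleSign_ofHom, ContinuousLinearMap.id_comp, a.γ_comp_γ, sub_self,
      smul_zero, map_zero, LinearMap.zero_apply, add_zero, map_smul, map_add, LinearMap.smul_apply,
      LinearMap.add_apply, FormFiber.one_mul]
    module
  · change FormFiber.comp _ _ (f.1 x) (ofHom _) = f.1 x
    rw [FormFiber.comp, rankSign_ofHom, FormFiber.mul_one, FormFiber.mul_one]
    module
/-- The compactly supported twisted Dolbeault category of holomorphic factorizations
`DF_c(X, W)`. -/
def DFc (W : HolFun V X) : DGCategory.{v, max v (w + 1), max u v w} (HolFun V X) where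
  Obj := HolFactorization.{u, v, w} W
  Hom a b := compactMor a b
  deg a b i := (degree a b i).submoduleOf (compactMor a b)
  isCompl_deg := isCompl_degree_compactMor
  comp := compactComp
  d := compactDelta
  comp_mem_deg _ _ _ _ _ _ _ hf hg := comp_mem_degree hf hg
  comp_assoc _ _ _ _ _ _ _ := Subtype.ext (HolFactorization.comp_assoc _ _ _)
  d_mem_deg _ _ _ _ hf := delta_mem_degree hf
  d_d _ _ _ := Subtype.ext (delta_delta _)
  leibniz _ _ _ _ _ g hf := compact_leibniz hf g

/-- The inclusion functor `DF_c(X, W) → DF(X, W)`. -/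
def inclusion (W : HolFun V X) : DGFunctor (DFc.{u, v, w} W) (DF.{u, v, w} W) where
  obj a := a
  map a b := (compactMor a b).subtype
  map_mem_deg _ _ _ _ hf := hf
  map_d _ _ _ := rfl
  map_comp _ _ _ _ _ := rfl

end Factorizations
end LG

end

universe u v w

/-! The heart of the matter is that, off the critical set, the identity of every factorization is
null-homotopic up to forms of positive rank. Differentiating `D² = W` in a direction `v` gives `D ∘
∂_v D + ∂_v D ∘ D = ∂_v W`. Where `∂_v W ≠ 0`, the quotient `∂_v D / ∂_v W` therefore has graded
commutator `id` with `D` (`exists_local_homotopy`). This relation is affine in the homotopy, so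
local solutions can be averaged with a smooth partition of unity on the complement of a compact
neighbourhood `K` of the critical set (`exists_global_homotopy`). Averaging destroys holomorphy, and
the odd part `s` of the result satisfies `δ s = id + ∂̄ s` off `K`. Thus `u = id - δ s` is even,
closed, cohomologous to `id`, and equal to the form `-∂̄ s` of positive rank off `K`
(`exists_odd_homotopy`).

Rank is additive under composition, and forms of rank above the dimension vanish. A sufficiently
high power `q` of `u` is consequently zero off `K`, hence compactly supported. Multiplying by the
closed form `u` changes a closed form only by a coboundary, so `q = id - δ r` with `r` odd
(`exists_compact_homotopy`). Left composition with `q` is then the projection `π`, and left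
composition with `r` is the homotopy `𝓡`. Indeed the Leibniz rule with `δ q = 0` makes `π` a chain
map, and with `r` odd it gives `f - q f = (δ r) f = δ (r f) + r (δ f)`. Both operators are
`O(X)`-linear. The first has values in compactly supported forms because `q` is compactly supported,
and the second preserves compact supports because composition is pointwise.

A homotopy equivalence induces bijections on cohomology. Essential surjectivity is immediate because
the inclusion is the identity on objects and the large category is unital. -/

noncomputable section
namespace LG

/-! ### Topological and smooth preliminaries -/

/-- A connected, paracompact, locally compact Hausdorff space is `σ`-compact. -/
theorem sigmaCompactSpace_of_connected {X : Type*} [TopologicalSpace X] [T2Space X]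
    [ParacompactSpace X] [LocallyCompactSpace X] [ConnectedSpace X] : SigmaCompactSpace X := by
  choose K hK hxK using fun x : X => exists_compact_mem_nhds x
  -- Paracompactness provides a locally finite open cover whose members have compact closures.
  obtain ⟨U, hUo, hUc, hUf, hUK⟩ := precise_refinement (fun x => interior (K x))
    (fun _ => isOpen_interior)
    (iUnion_eq_univ_iff.2 fun x => ⟨x, mem_interior_iff_mem_nhds.2 (hxK x)⟩)
  have hcl : ∀ x, IsCompact (closure (U x)) := fun x =>
    (hK x).of_isClosed_subset isClosed_closure
      (closure_minimal ((hUK x).trans interior_subset) (hK x).isClosed)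
  obtain ⟨x₀⟩ := (inferInstance : Nonempty X)
  -- The set grows from one point: each stage is the union of the closures of all members of the
  -- cover that meet the previous stage. By local finiteness a compact stage meets only finitely
  -- many of them, so every stage is compact.
  let C : ℕ → Set X := fun n =>
    Nat.rec {x₀} (fun _ S => ⋃ i ∈ {i | (U i ∩ S).Nonempty}, closure (U i)) n
  have hC : ∀ n, IsCompact (C n) := fun n => by
    induction n with
    | zero => exact isCompact_singleton
    | succ n ih => exact (hUf.finite_nonempty_inter_compact ih).isCompact_biUnion fun i _ => hcl i
  have hsucc : ∀ n i, (U i ∩ C n).Nonempty → closure (U i) ⊆ C (n + 1) := fun n i hi =>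
    subset_biUnion_of_mem (u := fun i => closure (U i))
      (show i ∈ {i | (U i ∩ C n).Nonempty} from hi)
  have hmem : ∀ y, ∃ i, y ∈ U i := iUnion_eq_univ_iff.1 hUc
  -- A member of the cover that meets the union meets some stage, so it lies in the next one. This
  -- makes the union both open and closed, and connectedness finishes the argument.
  have hclopen : IsClopen (⋃ n, C n) := by
    refine ⟨isClosed_of_closure_subset fun y hy => ?_, isOpen_iff_mem_nhds.2 fun y hy => ?_⟩
    · obtain ⟨i, hi⟩ := hmem y
      obtain ⟨z, hzU, hz⟩ := mem_closure_iff.1 hy _ (hUo i) hi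
      obtain ⟨n, hn⟩ := mem_iUnion.1 hz
      exact mem_iUnion.2 ⟨n + 1, hsucc n i ⟨z, hzU, hn⟩ (subset_closure hi)⟩
    · obtain ⟨n, hn⟩ := mem_iUnion.1 hy
      obtain ⟨i, hi⟩ := hmem y
      exact mem_of_superset ((hUo i).mem_nhds hi) ((subset_closure.trans
        (hsucc n i ⟨y, hi, hn⟩)).trans (subset_iUnion C (n + 1)))
  exact SigmaCompactSpace_iff_exists_compact_covering.2
    ⟨C, hC, hclopen.eq_univ ⟨x₀, mem_iUnion.2 ⟨0, rfl⟩⟩⟩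

/-- A complex manifold is a smooth real manifold. -/
theorem isManifold_real (V : Type*) [NormedAddCommGroup V] [NormedSpace ℂ V] (X : Type*)
    [TopologicalSpace X] [ChartedSpace V X] [IsManifold 𝓘(ℂ, V) ω X] : IsManifold 𝓘(ℝ, V) ∞ X := by
  refine isManifold_of_contDiffOn 𝓘(ℝ, V) ∞ X fun e e' he he' => ?_
  have h := (contDiffGroupoid ω 𝓘(ℂ, V)).compatible he he'
  rw [contDiffGroupoid, mem_groupoid_of_pregroupoid] at h
  replace h := h.1
  simp only [contDiffPregroupoid, modelWithCornersSelf_coe, modelWithCornersSelf_coe_symm,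
    Function.comp_id, Function.id_comp, range_id, preimage_id, inter_univ] at h ⊢
  exact (h.restrict_scalars ℝ).of_le le_top

/-! ### The rank filtration on the fibers -/

section Fiber

variable {T : Type*} [AddCommGroup T] [Module ℂ T] [TopologicalSpace T]
  {T' : Type*} [AddCommGroup T'] [Module ℂ T'] [TopologicalSpace T']
  {E : Type*} [AddCommGroup E] [Module ℂ E] [TopologicalSpace E] [IsTopologicalAddGroup E]
  [ContinuousSMul ℂ E]
  {G : Type*} [AddCommGroup G] [Module ℂ G] [TopologicalSpace G] [IsTopologicalAddGroup G]
  [ContinuousSMul ℂ G]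
  {K : Type*} [AddCommGroup K] [Module ℂ K] [TopologicalSpace K] [IsTopologicalAddGroup K]
  [ContinuousSMul ℂ K]
  {L : Type*} [AddCommGroup L] [Module ℂ L] [TopologicalSpace L] [IsTopologicalAddGroup L]
  [ContinuousSMul ℂ L]

namespace FormFiber

variable (T E G) in
/-- The forms of rank at least `k`. -/
def rankGE : ℕ → Submodule ℂ (FormFiber T E G)
  | 0 => ⊤
  | k + 1 => Submodule.span ℂ
      {x | ∃ (u : T →L⋆[ℂ] ℂ) (y : FormFiber T E G), y ∈ rankGE k ∧ x = wedge u y}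

theorem wedge_mem_rankGE {k : ℕ} (u : T →L⋆[ℂ] ℂ) {y : FormFiber T E G} (hy : y ∈ rankGE T E G k) :
    wedge u y ∈ rankGE T E G (k + 1) :=
  Submodule.subset_span ⟨u, y, hy, rfl⟩

/-- A linear map that commutes with exterior multiplication, up to pullback and signs, preserves
the rank filtration. -/
theorem rankGE_le_comap {c : ℂ} {g : (T →L⋆[ℂ] ℂ) → (T' →L⋆[ℂ] ℂ)}
    (φ : FormFiber T E G →ₗ[ℂ] FormFiber T' K L)
    (hφ : ∀ u x, φ (wedge u x) = c • wedge (g u) (φ x)) (k : ℕ) :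
    rankGE T E G k ≤ (rankGE T' K L k).comap φ := by
  induction k with
  | zero => exact le_top
  | succ k ih =>
    refine Submodule.span_le.2 ?_
    rintro _ ⟨u, y, hy, rfl⟩
    rw [SetLike.mem_coe, Submodule.mem_comap, hφ]
    exact Submodule.smul_mem _ _ (wedge_mem_rankGE _ (ih hy))

theorem rankSign_mem_rankGE {k : ℕ} {x : FormFiber T E G} (hx : x ∈ rankGE T E G k) :
    rankSign x ∈ rankGE T E G k :=
  rankGE_le_comap (c := -1) (g := id) rankSign
    (fun u x => by rw [rankSign_wedge, neg_one_smul, id]) k hx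

theorem map_mem_rankGE (A : T' →L[ℂ] T) (a : L →L[ℂ] E) (b : G →L[ℂ] K) {k : ℕ}
    {x : FormFiber T E G} (hx : x ∈ rankGE T E G k) : map A a b x ∈ rankGE T' L K k :=
  rankGE_le_comap (c := 1) (g := fun u => u.comp A) (map A a b)
    (fun u x => by rw [map_wedge, one_smul]) k hx

/-- A covector in the right factor can be moved to the far left at the cost of a rank sign on the
left factor, so left multiplication by any form preserves the filtration. The covector present in
`x` then contributes one more rank. -/
theorem mul_mem_rankGE_succ {k : ℕ} {x : FormFiber T G K} {y : FormFiber T E G}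
    (hx : x ∈ rankGE T G K 1) (hy : y ∈ rankGE T E G k) : mul x y ∈ rankGE T E K (k + 1) := by
  -- The induction needs all `x` at once, since moving a covector past `x` replaces `x` by `rankSign
  -- x`.
  have h : ∀ (k : ℕ) (x : FormFiber T G K) (y : FormFiber T E G), y ∈ rankGE T E G k →
      mul x y ∈ rankGE T E K k := fun k => by
    induction k with
    | zero => exact fun _ _ _ => Submodule.mem_top
    | succ k ih =>
      intro x y hy
      induction hy using Submodule.span_induction with
      | mem _ h =>
        obtain ⟨u, y, hy, rfl⟩ := h
        rw [mul_wedge]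
        exact wedge_mem_rankGE u (ih _ _ hy)
      | zero => rw [map_zero]; exact Submodule.zero_mem _
      | add _ _ _ _ h h' => rw [map_add]; exact Submodule.add_mem _ h h'
      | smul c _ _ h => rw [map_smul]; exact Submodule.smul_mem _ c h
  induction hx using Submodule.span_induction with
  | mem _ hx =>
    obtain ⟨u, x, -, rfl⟩ := hx
    rw [wedge_mul]
    exact wedge_mem_rankGE u (h _ _ _ hy)
  | zero => rw [map_zero]; exact Submodule.zero_mem _
  | add _ _ _ _ h h' => rw [map_add]; exact Submodule.add_mem _ h h'
  | smul c _ _ h => rw [map_smul]; exact Submodule.smul_mem _ c h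

/-- The signed composition is a sum of two unsigned products. Splitting `x` by bundle parity and
applying the rank sign to `y` both preserve the filtration, so the signs do no harm. -/
theorem comp_mem_rankGE_succ {γ'' : K →L[ℂ] K} {γ' : G →L[ℂ] G} {k : ℕ} {x : FormFiber T G K}
    {y : FormFiber T E G} (hx : x ∈ rankGE T G K 1) (hy : y ∈ rankGE T E G k) :
    comp γ'' γ' x y ∈ rankGE T E K (k + 1) := by
  have hb : bundleSign γ'' γ' x ∈ rankGE T G K 1 := map_mem_rankGE _ _ _ hx
  exact Submodule.add_mem _
    (mul_mem_rankGE_succ (Submodule.smul_mem _ _ (Submodule.add_mem _ hx hb)) hy)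
    (mul_mem_rankGE_succ (Submodule.smul_mem _ _ (Submodule.sub_mem _ hx hb))
      (rankSign_mem_rankGE hy))

/-- Forms in the `n`-th step are spanned by tensors whose exterior part begins with a product of `n`
covectors, and such a product vanishes when `n` exceeds the dimension. This is what makes the
iterated error term disappear. -/
theorem rankGE_eq_bot {n : ℕ} [FiniteDimensional ℂ (T →L⋆[ℂ] ℂ)]
    (hn : Module.finrank ℂ (T →L⋆[ℂ] ℂ) < n) : rankGE T E G n = ⊥ := by
  -- The arbitrary factor `ρ` is kept because the filtration bounds the rank only from below.
  have h : ∀ k, rankGE T E G k ≤ Submodule.span ℂ {x | ∃ (v : Fin k → T →L⋆[ℂ] ℂ)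
      (ρ : AntiExt T) (f : E →L[ℂ] G), x = tmul (ExteriorAlgebra.ιMulti ℂ k v * ρ) f} := fun k => by
    induction k with
    | zero =>
      intro x _
      induction x using induction with
      | h0 => exact Submodule.zero_mem _
      | ht ρ f =>
        refine Submodule.subset_span ⟨0, ρ, f, ?_⟩
        rw [ExteriorAlgebra.ιMulti_zero_apply, _root_.one_mul]
      | ha _ _ h h' => exact Submodule.add_mem _ (h trivial) (h' trivial)
    | succ k ih =>
      refine Submodule.span_le.2 ?_
      rintro _ ⟨u, y, hy, rfl⟩
      rw [SetLike.mem_coe]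
      replace hy := ih hy
      induction hy using Submodule.span_induction with
      | mem _ h =>
        obtain ⟨v, ρ, f, rfl⟩ := h
        refine Submodule.subset_span ⟨Matrix.vecCons u v, ρ, f, ?_⟩
        rw [wedge_tmul, ExteriorAlgebra.ιMulti_succ_apply, Matrix.tail_cons, Matrix.cons_val_zero,
          _root_.mul_assoc]
      | zero => rw [map_zero]; exact Submodule.zero_mem _
      | add _ _ _ _ h h' => rw [map_add]; exact Submodule.add_mem _ h h'
      | smul c _ _ h => rw [map_smul]; exact Submodule.smul_mem _ c h
  refine eq_bot_iff.2 ((h n).trans (Submodule.span_le.2 ?_))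
  rintro _ ⟨v, ρ, f, rfl⟩
  have hv : ¬LinearIndependent ℂ v := fun hv => by
    have := hv.fintype_card_le_finrank
    rw [Fintype.card_fin] at this
    omega
  rw [AlternatingMap.map_linearDependent _ v hv, zero_mul]
  exact TensorProduct.zero_tmul _ _

end FormFiber
end Fiber
-- Pointwise smoothness, gluing, and local homotopies off the critical set
section SmoothAt

variable {V : Type u} [NormedAddCommGroup V] [NormedSpace ℂ V] [FiniteDimensional ℂ V]
  {X : Type v} [TopologicalSpace X] [ChartedSpace V X] [IsManifold 𝓘(ℂ, V) ω X]
  {A B C D : HolBundle.{u, v, w} V X}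

open FormFiber

/-- Smoothness of a form at a point. -/
def IsSmoothAt (α : RawForm A B) (p : X) : Prop :=
  ContDiffAt ℝ ∞ (rep p α) (chartAt V p p)

theorem eventually_symm {P : X → Prop} {p y : X} (hy : y ∈ (chartAt V p).source)
    (h : ∀ᶠ x in 𝓝 y, P x) : ∀ᶠ z in 𝓝 (chartAt V p y), P ((chartAt V p).symm z) := by
  have hs : (chartAt V p).symm (chartAt V p y) = y := (chartAt V p).left_inv hy
  have hc := (chartAt V p).continuousAt_symm ((chartAt V p).map_source hy)
  exact hc.eventually (hs.symm ▸ h)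

theorem IsSmoothAt.congr {α β : RawForm A B} {p : X} (hα : IsSmoothAt α p)
    (h : ∀ᶠ x in 𝓝 p, β x = α x) : IsSmoothAt β p := by
  refine ContDiffAt.congr_of_eventuallyEq hα ?_
  filter_upwards [eventually_symm (mem_chart_source V p) h] with z hz
  rw [rep, rep, hz]

/-- Smoothness at a point may be checked in any of the preferred charts. -/
theorem isSmoothAt_of_rep {α : RawForm A B} {p y : X} (hy : y ∈ dom A B p)
    (hα : ContDiffAt ℝ ∞ (rep p α) (chartAt V p y)) : IsSmoothAt α y := by
  have hd := mem_dom (A := A) (B := B) y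
  have hev : ∀ᶠ z in 𝓝 (chartAt V y y), z ∈ (chartAt V y).target ∧
      (chartAt V y).symm z ∈ dom A B p ∧ (chartAt V y).symm z ∈ dom A B y := by
    filter_upwards [eventually_dom hd, eventually_symm (mem_chart_source V y)
      ((isOpen_dom p).mem_nhds hy)] with z h1 h2
    exact ⟨h1.1, h2, h1.2.1⟩
  have hT : chgT y p =ᶠ[𝓝 (chartAt V y y)] fderiv ℂ (chg y p) :=
    hev.mono fun z hz => chgT_eq hz.1 hz.2.1.1
  -- The chart and frames at `p` are changed into those at `y`. Smoothness of `α` is assumed at the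
  -- single point `y` only, so the transition law for globally smooth forms does not apply.
  have h := LG.transition (contDiffAt_chg hd.1 hy.1) hT
    (contDiffAt_chgF (A := A) hd.1 hd.2.1 hy.2.1) (contDiffAt_chgF (A := B) hd.1 hy.2.2 hd.2.2)
    (f := rep p α) (by rw [chg, (chartAt V y).left_inv hd.1]; exact hα)
  refine h.1.congr_of_eventuallyEq ?_
  filter_upwards [hev] with z ⟨hz, hp, hy⟩
  set x := (chartAt V y).symm z with hx
  have h : (chartAt V p).symm (chg y p z) = x := (chartAt V p).left_inv hp.1
  have h' : rep p α (chg y p z) = toModel p x (α x) :=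
    congrArg (fun x => toModel p x (α x)) h
  have h1 : (trivializationAt V (TangentSpace 𝓘(ℂ, V)) p).symmL ℂ x ∘L chgT y p z =
      (trivializationAt V (TangentSpace 𝓘(ℂ, V)) y).symmL ℂ x := by
    ext v
    exact Trivialization.symmL_continuousLinearMapAt _ hp.1 _
  have h2 : (trivializationAt A.F A.E p).symmL ℂ x ∘L chgF A y y p z =
      (trivializationAt A.F A.E y).symmL ℂ x := by
    ext v
    exact Trivialization.symmL_continuousLinearMapAt _ hp.2.1 _
  have h3 : chgF B y p y z ∘L (trivializationAt B.F B.E p).continuousLinearMapAt ℂ x =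
      (trivializationAt B.F B.E y).continuousLinearMapAt ℂ x := by
    ext v
    exact congrArg _ (Trivialization.symmL_continuousLinearMapAt _ hp.2.2 _)
  rw [h', toModel, FormFiber.map_map, h1, h2, h3]
  rfl

/-- Cut-off functions are smooth only over `ℝ`, so `X` is viewed here as a real manifold. It has the
same charts, hence the local expressions of `f` and `α` can be multiplied directly. -/
theorem IsSmoothAt.realSmul {α : RawForm A B} {p : X} (hα : IsSmoothAt α p) {f : X → ℝ}
    (hf : ContMDiff 𝓘(ℝ, V) 𝓘(ℝ, ℝ) ∞ f) : IsSmoothAt (fun x => (f x : ℂ) • α x) p := by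
  have := isManifold_real V X
  have ht := (chartAt V p).map_source (mem_chart_source V p)
  have h1 : ContMDiffAt 𝓘(ℝ, V) 𝓘(ℝ, V) ∞ (chartAt V p).symm (chartAt V p p) :=
    contMDiffOn_chart_symm.contMDiffAt ((chartAt V p).open_target.mem_nhds ht)
  have h2 : ContDiffAt ℝ ∞ (fun z => f ((chartAt V p).symm z)) (chartAt V p p) :=
    contMDiffAt_iff_contDiffAt.1 (hf.contMDiffAt.comp _ h1)
  have h3 : rep p (fun x => (f x : ℂ) • α x) =
      fun z => f ((chartAt V p).symm z) • rep p α z := by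
    funext z
    rw [rep, map_smul, Complex.coe_smul]
    rfl
  rw [IsSmoothAt, h3]
  exact h2.smul hα

theorem IsSmoothAt.sum {ι : Type*} {t : Finset ι} {α : ι → RawForm A B} {p : X}
    (h : ∀ i ∈ t, IsSmoothAt (α i) p) : IsSmoothAt (fun x => ∑ i ∈ t, α i x) p := by
  have h1 : rep p (fun x => ∑ i ∈ t, α i x) = fun z => ∑ i ∈ t, rep p (α i) z :=
    funext fun z => map_sum _ _ _
  rw [IsSmoothAt, h1]
  exact ContDiffAt.sum h

/-- Local sections glue along a smooth partition of unity. -/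
theorem isSmooth_finsum {ι : Type*} {s : Set X} (f : SmoothPartitionOfUnity ι 𝓘(ℝ, V) X s)
    {U : ι → Set X} (hU : f.IsSubordinate U) {α : ι → RawForm A B}
    (hα : ∀ i, ∀ x ∈ U i, IsSmoothAt (α i) x) :
    IsSmooth (fun x => ∑ᶠ i, (f i x : ℂ) • α i x) := fun p => by
  have h1 : ∀ i, IsSmoothAt (fun x => (f i x : ℂ) • α i x) p := fun i => by
    -- The form `α i` is known to be smooth only on `U i`, which contains the closed support of `f
    -- i`. Outside that support the product vanishes near `p`, whatever `α i` is.
    by_cases hp : p ∈ tsupport (f i)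
    · exact (hα i p (hU i hp)).realSmul (f i).contMDiff
    · refine IsSmoothAt.congr (IsSmooth.zero p) ?_
      filter_upwards [(isClosed_tsupport _).isOpen_compl.mem_nhds hp] with x hx
      rw [image_eq_zero_of_notMem_tsupport hx, Complex.ofReal_zero, zero_smul]
      rfl
  refine IsSmoothAt.congr (IsSmoothAt.sum fun i (_ : i ∈ f.fintsupport p) => h1 i) ?_
  filter_upwards [f.eventually_fintsupport_subset p] with x hx
  refine finsum_eq_sum_of_support_subset _ fun i hi => ?_
  refine hx ((f.mem_fintsupport_iff x i).2 (subset_tsupport _ ?_))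
  intro h
  exact hi (by simp only [h, Complex.ofReal_zero, zero_smul])

theorem toModel_injective {p y : X} (hy : y ∈ dom A B p) :
    Function.Injective (toModel (A := A) (B := B) p y) :=
  Function.LeftInverse.injective (ofModel_toModel hy)

theorem toModel_ofHom_id {p y : X} (hy : y ∈ dom A A p) :
    toModel p y (ofHom (.id ℂ (A.E y))) = ofHom (.id ℂ A.F) := by
  rw [toModel, map_ofHom]
  congr 1
  ext v
  exact Trivialization.continuousLinearMapAt_symmL _ hy.2.1 v

/-- Differentiating `φ ∘ f = f` gives the claim by the chain rule. With `φ` the rank sign operator,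
it shows that the derivative of the local expression of `D` is still invariant under the rank sign.
-/
theorem map_fderiv_eq_self {S : Type*} [NormedAddCommGroup S] [NormedSpace ℂ S]
    [FiniteDimensional ℂ S] {f : V → S} {z : V} (hf : DifferentiableAt ℝ f z) {φ : S →ₗ[ℂ] S} (hφ : ∀ z, φ (f z) = f z)
    (v : V) : φ (fderiv ℝ f z v) = fderiv ℝ f z v := by
  have h : fderiv ℝ (fun z => φ (f z)) z = (realLin φ).comp (fderiv ℝ f z) :=
    ((realLin φ).hasFDerivAt.comp z hf.hasFDerivAt).fderiv
  simp only [hφ] at h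
  exact (congrArg (fun ψ : V →L[ℝ] S => ψ v) h).symm

/-- Where `∂W ≠ 0`, a holomorphic endomorphism with square `W` has a local contracting homotopy,
the logarithmic derivative of `D` in a direction where `W` is not stationary. -/
theorem exists_local_homotopy {W : HolFun V X} {D : ∀ x, A.E x →L[ℂ] A.E x}
    (hD : IsHolHom A A D) (hDD : ∀ x, (D x).comp (D x) = W x • .id ℂ (A.E x)) {p : X}
    (hp : p ∉ critSet W) :
    ∃ α : RawForm A A, ∀ᶠ y in 𝓝 p, IsSmoothAt α y ∧ rankSign (α y) = α y ∧
      mul (ofHom (D y)) (α y) + mul (α y) (ofHom (D y)) = ofHom (.id ℂ (A.E y)) := by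
  set w : V → ℂ := fun z => W ((chartAt V p).symm z) with hw
  set d : V → FormFiber V A.F A.F := rep p (fun x => ofHom (D x)) with hd
  have hwp : ContDiffAt ℂ ω w (chartAt V p p) := W.contDiffAt p
  -- At the centre of the chart, the manifold derivative of `W` is by definition the derivative of
  -- its local expression `w`.
  have hne : fderiv ℂ w (chartAt V p p) ≠ 0 := fun h => hp (by
    have hm : MDifferentiableAt 𝓘(ℂ, V) 𝓘(ℂ, ℂ) W p :=
      W.contMDiff.contMDiffAt.mdifferentiableAt (by simp)
    have h1 : fderivWithin ℂ (writtenInExtChartAt 𝓘(ℂ, V) 𝓘(ℂ, ℂ) p W) (range 𝓘(ℂ, V))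
        (extChartAt 𝓘(ℂ, V) p p) = 0 := by
      simp only [writtenInExtChartAt, extChartAt, mfld_simps, fderivWithin_univ]
      exact h
    exact hm.mfderiv.trans h1)
  obtain ⟨v, hv⟩ : ∃ v, fderiv ℂ w (chartAt V p p) v ≠ 0 := by
    by_contra! h
    exact hne (ContinuousLinearMap.ext h)
  have hg : ∀ {z}, ContDiffAt ℂ ω w z → ContDiffAt ℂ ω (fun z => fderiv ℂ w z v) z := fun h =>
    (h.fderiv_right (m := ω) le_rfl).clm_apply contDiffAt_const
  -- The homotopy is `∂_v D / ∂_v W` in coordinates. The real derivative is taken because smoothness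
  -- of forms is a real notion; the denominator is the complex derivative of `w`.
  set S : V → FormFiber V A.F A.F := fun z => (fderiv ℂ w z v)⁻¹ • fderiv ℝ d z v with hS
  have hdx : ∀ {y}, y ∈ dom A A p → ContDiffAt ℝ ∞ d (chartAt V p y) := fun hy =>
    (hD.isSmooth.transition hy).1
  have hdr : ∀ z, rankSign (d z) = d z := fun z => by
    have h := congrFun (rep_rankSign p (fun x => ofHom (D x) : RawForm A A)) z
    simp only [rankSign_ofHom] at h
    exact h.symm
  have hdd : ∀ {y}, y ∈ dom A A p → mul (toModel p y (ofHom (D y))) (toModel p y (ofHom (D y))) =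
      W y • ofHom (.id ℂ A.F) := fun {y} hy => by
    rw [← toModel_mul hy, ofHom_mul_ofHom, hDD, map_smul, map_smul, toModel_ofHom_id hy]
  have hev : ∀ᶠ z in 𝓝 (chartAt V p p), ContDiffAt ℂ ω w z ∧ fderiv ℂ w z v ≠ 0 :=
    (hwp.eventually (by simp)).and ((hg hwp).continuousAt.eventually_ne hv)
  -- The field is defined on all of `X`, but it is meaningful only near `p`. This is enough, since
  -- gluing uses it only on a neighbourhood.
  refine ⟨fun y => ofModel p y (S (chartAt V p y)), ?_⟩
  filter_upwards [((chartAt V p).continuousAt (mem_chart_source V p)).eventually hev,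
    (isOpen_dom p).mem_nhds (mem_dom (A := A) (B := A) p)] with y ⟨hwy, hgy⟩ hy
  have hfd : ContDiffAt ℝ ∞ (fun z => fderiv ℝ d z v) (chartAt V p y) :=
    ((hdx hy).fderiv_right (m := ∞) (by simp)).clm_apply contDiffAt_const
  have hyd : d (chartAt V p y) = toModel p y (ofHom (D y)) :=
    congrArg (fun x => toModel p x (ofHom (D x))) ((chartAt V p).left_inv hy.1)
  refine ⟨isSmoothAt_of_rep hy ?_, ?_, toModel_injective hy ?_⟩
  · have hSs : ContDiffAt ℝ ∞ S (chartAt V p y) :=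
      ((((hg hwy).inv hgy).restrict_scalars ℝ).of_le le_top).smul hfd
    refine hSs.congr_of_eventuallyEq ?_
    filter_upwards [eventually_dom hy] with z hz
    rw [rep, toModel_ofModel hz.2.1, (chartAt V p).right_inv hz.1]
  · rw [ofModel, ← map_rankSign, hS]
    simp only [map_smul]
    rw [map_fderiv_eq_self ((hdx hy).differentiableAt (by simp)) hdr]
  · rw [map_add, toModel_mul hy, toModel_mul hy, toModel_ofModel hy, toModel_ofHom_id hy, ← hyd]
    -- The local form of `D² = W • id` is differentiated in the direction `v`. Uniqueness of the
    -- derivative equates the product rule for `d * d` with the derivative of `w • id`.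
    have h1 : HasFDerivAt (fun z => realBilin mul (d z) (d z)) _ (chartAt V p y) :=
      (realBilin (mul : FormFiber V A.F A.F →ₗ[ℂ] FormFiber V A.F A.F →ₗ[ℂ]
        _)).hasFDerivAt_of_bilinear
        ((hdx hy).differentiableAt (by simp)).hasFDerivAt
        ((hdx hy).differentiableAt (by simp)).hasFDerivAt
    have h2 : HasFDerivAt (fun z => w z • (ofHom (.id ℂ A.F) : FormFiber V A.F A.F)) _
        (chartAt V p y) :=
      ((hwy.differentiableAt (by simp)).hasFDerivAt.restrictScalars ℝ).smul_const _
    have h3 : (fun z => w z • (ofHom (.id ℂ A.F) : FormFiber V A.F A.F)) =ᶠ[𝓝 (chartAt V p y)]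
        fun z => mul (d z) (d z) := by
      filter_upwards [eventually_dom hy] with z hz
      exact (hdd hz.2.1).symm
    have h4 := congrArg (fun ψ : V →L[ℝ] FormFiber V A.F A.F => ψ v)
      (h1.unique (h2.congr_of_eventuallyEq h3.symm))
    have h5 : mul (d (chartAt V p y)) (fderiv ℝ d (chartAt V p y) v) +
        mul (fderiv ℝ d (chartAt V p y) v) (d (chartAt V p y)) =
        fderiv ℂ w (chartAt V p y) v • ofHom (.id ℂ A.F) := h4
    simp only [hS, map_smul, LinearMap.smul_apply]
    rw [← smul_add, h5, smul_smul, inv_mul_cancel₀ hgy, one_smul]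

end SmoothAt
-- From local homotopies to a compactly supported replacement of the identity
section Homotopy

variable {V : Type u} [NormedAddCommGroup V] [NormedSpace ℂ V] [FiniteDimensional ℂ V]
  {X : Type v} [TopologicalSpace X] [ChartedSpace V X] [IsManifold 𝓘(ℂ, V) ω X]

open FormFiber Form

/-- Every summand of `∂̄` starts with a factor `dz̄ⁱ`. Hence the failure of the glued homotopy to be
holomorphic costs only terms of positive rank. -/
theorem dbar_mem_rankGE {A B : HolBundle.{u, v, w} V X} (α : RawForm A B) (x : X) :
    dbar α x ∈ rankGE (TangentSpace 𝓘(ℂ, V) x) (A.E x) (B.E x) 1 :=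
  map_mem_rankGE _ _ _ (Submodule.sum_mem _ fun _ _ => wedge_mem_rankGE _ Submodule.mem_top)

/-- All tangent spaces are copies of `V`, so one bound `n` works at every point. This allows a
single power of the error form to vanish everywhere off the compact set. -/
theorem eq_zero_of_mem_rankGE {A B : HolBundle.{u, v, w} V X} {x : X} {n : ℕ}
    (hn : Module.finrank ℂ (V →L⋆[ℂ] ℂ) < n)
    {y : FormFiber (TangentSpace 𝓘(ℂ, V) x) (A.E x) (B.E x)}
    (hy : y ∈ rankGE (TangentSpace 𝓘(ℂ, V) x) (A.E x) (B.E x) n) : y = 0 := by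
  have h : rankGE (TangentSpace 𝓘(ℂ, V) x) (A.E x) (B.E x) n = ⊥ :=
    rankGE_eq_bot (T := V) (E := A.E x) (G := B.E x) hn
  rw [h] at hy
  exact (Submodule.mem_bot ℂ).1 hy

variable {W : HolFun V X}

namespace HolFactorization

/-- The local homotopies given by the logarithmic derivatives of `D`, glued along a partition of
unity. -/
theorem exists_global_homotopy [T2Space X] [SigmaCompactSpace X]
    (hW : IsCompact (critSet W)) (b : HolFactorization.{u, v, w} W) :
    ∃ K : Set X, IsCompact K ∧ ∃ s : Mor b b, ∀ x, rankSign (s.1 x) = s.1 x ∧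
      (x ∉ K → mul (ofHom (b.D x)) (s.1 x) + mul (s.1 x) (ofHom (b.D x)) =
        ofHom (.id ℂ (b.E x))) := by
  have := isManifold_real V X
  have : ProperSpace V := FiniteDimensional.proper ℂ V
  have : LocallyCompactSpace X := ChartedSpace.locallyCompactSpace V X
  have : FiniteDimensional ℝ V := FiniteDimensional.complexToReal V
  -- A compact neighbourhood is needed rather than the critical set itself: the complement of its
  -- interior is closed, as the partition of unity requires, and is still disjoint from the critical
  -- set.
  obtain ⟨K, hK, hWK⟩ := exists_compact_superset hW
  choose α hα using fun p : {p // p ∉ critSet W} =>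
    exists_local_homotopy b.isHolHom_D b.D_comp_D p.2
  let U : {p // p ∉ critSet W} → Set X := fun p => interior {y | IsSmoothAt (α p) y ∧
    rankSign (α p y) = α p y ∧
      mul (ofHom (b.D y)) (α p y) + mul (α p y) (ofHom (b.D y)) = ofHom (.id ℂ (b.E y))}
  have hUα : ∀ p, ∀ y ∈ U p, _ := fun p y hy => interior_subset hy
  obtain ⟨f, hf⟩ := SmoothPartitionOfUnity.exists_isSubordinate 𝓘(ℝ, V)
    isOpen_interior.isClosed_compl U (fun _ => isOpen_interior) (s := (interior K)ᶜ)
    fun p hp => mem_iUnion.2 ⟨⟨p, fun h => hp (hWK h)⟩, mem_interior_iff_mem_nhds.2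
      (hα ⟨p, fun h => hp (hWK h)⟩)⟩
  have hsum : ∀ x, ∑ᶠ i, (f i x : ℂ) • α i x = ∑ i ∈ f.finsupport x, (f i x : ℂ) • α i x :=
    fun x => finsum_eq_sum_of_support_subset _ fun i hi => by
      rw [f.coe_finsupport]
      intro h
      exact hi (by simp only [h, Complex.ofReal_zero, zero_smul])
  have hmem : ∀ x, ∀ i ∈ f.finsupport x, x ∈ U i := fun x i hi =>
    hf i (subset_tsupport _ ((f.mem_finsupport x).1 hi))
  refine ⟨K, hK, ⟨_, isSmooth_finsum f hf fun i x hx => (hUα i x hx).1⟩, fun x => ?_⟩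
  simp only [hsum]
  refine ⟨?_, fun hx => ?_⟩
  · rw [map_sum]
    exact Finset.sum_congr rfl fun i hi => by rw [map_smul, (hUα i x (hmem x i hi)).2.1]
  -- Off `K` the weights sum to `1`. The commutator with `D` is linear in the form and each term
  -- with non-zero weight has commutator `id`, so the average has commutator `id` too.
  · have h1 : ∑ i ∈ f.finsupport x, (f i x : ℂ) = 1 := by
      rw [← Complex.ofReal_sum, f.sum_finsupport x fun h => hx (interior_subset h),
        Complex.ofReal_one]
    rw [map_sum, map_sum, LinearMap.sum_apply, ← Finset.sum_add_distrib]
    conv_rhs => rw [← one_smul ℂ (ofHom _), ← h1, Finset.sum_smul]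
    refine Finset.sum_congr rfl fun i hi => ?_
    rw [map_smul, map_smul, LinearMap.smul_apply, ← smul_add, (hUα i x (hmem x i hi)).2.2]

/-- Off a compact set, the identity is, up to forms of positive rank, the differential of an odd
form. -/
theorem exists_odd_homotopy [T2Space X] [SigmaCompactSpace X]
    (hW : IsCompact (critSet W)) (b : HolFactorization.{u, v, w} W) :
    ∃ K : Set X, IsCompact K ∧ ∃ s ∈ degree b b 1, ∀ x ∉ K,
      ofHom (.id ℂ (b.E x)) - (delta b b s).1 x ∈
        rankGE (TangentSpace 𝓘(ℂ, V) x) (b.E x) (b.E x) 1 := by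
  obtain ⟨K, hK, α, hα⟩ := exists_global_homotopy hW b
  -- Since `α` is invariant under the rank sign, its total parity is its bundle parity.
  have hts : totalSignLin b b α = bundleSignLin b b α := Form.ext fun x => by
    change rankSign (bundleSign _ _ (α.1 x)) = bundleSign _ _ (α.1 x)
    rw [← bundleSign_rankSign, (hα x).1]
  have hs := sub_mem_degree α
  refine ⟨K, hK, _, hs, fun x hx => ?_⟩
  -- The glued form need not be homogeneous, so its odd part is taken. The next steps check that
  -- this preserves both invariance under the rank sign and the commutator relation.
  set s : Mor b b := (half : HolFun V X) • (α - totalSignLin b b α) with hs_def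
  have hsx : s.1 x = (2⁻¹ : ℂ) • (α.1 x - bundleSign (b.γ x) (b.γ x) (α.1 x)) := by
    rw [hs_def, hts]
    rfl
  have hodd : rankSign (bundleSign (b.γ x) (b.γ x) (s.1 x)) = -s.1 x := by
    have h := congrArg (fun β : Mor b b => β.1 x) (mem_degree.1 hs)
    rw [uzpow_one, Units.neg_smul, one_smul] at h
    exact h
  have hrank : rankSign (s.1 x) = s.1 x := by
    rw [hsx, map_smul, map_sub, ← bundleSign_rankSign, (hα x).1]
  have hcomm := (hα x).2 hx
  -- Conjugation by the involution `γ` fixes `id` and negates `D`. So `γ α γ` satisfies the same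
  -- relation with the opposite sign, and half the difference `α - γ α γ` satisfies the original
  -- one.
  have hcomm' := congrArg (bundleSign (b.γ x) (b.γ x)) hcomm
  rw [map_add, bundleSign_mul (b.γ_comp_γ x), bundleSign_mul (b.γ_comp_γ x), bundleSign_ofHom,
    bundleSign_ofHom, b.D_odd, ContinuousLinearMap.id_comp, b.γ_comp_γ] at hcomm'
  -- For an odd form fixed by the rank sign, the two signs in the defect differential turn it into
  -- the anticommutator `D s + s D`.
  have hdef : FormFiber.defect (b.γ x) (b.D x) (b.γ x) (b.D x) (s.1 x) =
      ofHom (.id ℂ (b.E x)) := by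
    rw [defect_apply, hodd, hrank, hsx]
    simp only [map_smul, map_sub, map_neg, LinearMap.smul_apply, LinearMap.sub_apply,
      LinearMap.neg_apply] at hcomm' ⊢
    have h2 : (2⁻¹ : ℂ) • (ofHom (.id ℂ (b.E x)) + ofHom (.id ℂ (b.E x))) =
        (ofHom (.id ℂ (b.E x)) : FormFiber (TangentSpace 𝓘(ℂ, V) x) (b.E x) (b.E x)) := by
      module
    rw [← h2]
    nth_rw 1 [← hcomm]
    rw [← hcomm']
    module
  have h : ofHom (.id ℂ (b.E x)) - (delta b b s).1 x = -dbar s.1 x := by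
    change ofHom (.id ℂ (b.E x)) - (dbar s.1 x + FormFiber.defect _ _ _ _ (s.1 x)) = _
    rw [hdef]
    abel
  rw [h]
  exact Submodule.neg_mem _ (dbar_mem_rankGE _ _)

/-- Unitality asserts only that some identity exists. Its pointwise values, needed to compare ranks,
are recovered by composing it with the constant identity form, which is a right unit at every point.
-/
theorem exists_unit (b : HolFactorization.{u, v, w} W) :
    ∃ e ∈ degree b b 0, delta b b e = 0 ∧ (∀ x, e.1 x = ofHom (.id ℂ (b.E x))) ∧
      ∀ a f, comp a b b e f = f := by
  obtain ⟨e, he, hd, hl, -⟩ := isUnital_DF W b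
  refine ⟨e, he, hd, fun x => ?_, hl⟩
  have h := congrArg (fun β : Mor b b => β.1 x) (hl b (ofHolHom (isHolHom_id b.toHolBundle)))
  refine Eq.trans ?_ h
  change _ = FormFiber.comp _ _ (e.1 x) (ofHom _)
  rw [FormFiber.comp, rankSign_ofHom, FormFiber.mul_one, FormFiber.mul_one]
  module

/-- If the critical set is compact, the identity of `b` is homotopic to a compactly supported
form. -/
theorem exists_compact_homotopy [T2Space X] [SigmaCompactSpace X]
    (hW : IsCompact (critSet W)) (b : HolFactorization.{u, v, w} W) :
    ∃ q ∈ compactMor b b, q ∈ degree b b 0 ∧ ∃ r ∈ degree b b 1,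
      ∀ (a : HolFactorization.{u, v, w} W) (f : Mor a b),
        comp a b b q (delta a b f) = delta a b (comp a b b q f) ∧
        f - comp a b b q f = delta a b (comp a b b r f) + comp a b b r (delta a b f) := by
  obtain ⟨K, hK, s, hs, hsK⟩ := exists_odd_homotopy hW b
  obtain ⟨e, he, hde, hex, hel⟩ := exists_unit b
  have h11 : (1 + 1 : ZMod 2) = 0 := rfl
  -- With `u = e - δ s`, the form `q` is the `k`-th power of `u`. The primitive `r` is carried
  -- along, so that `q` stays cohomologous to `e`; off `K` each factor `u` adds at least one to the
  -- rank.
  have key : ∀ k : ℕ, ∃ q ∈ degree b b 0, ∃ r ∈ degree b b 1, q = e - delta b b r ∧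
      ∀ x ∉ K, q.1 x ∈ rankGE (TangentSpace 𝓘(ℂ, V) x) (b.E x) (b.E x) k := fun k => by
    induction k with
    | zero => exact ⟨e, he, 0, Submodule.zero_mem _, by rw [map_zero, sub_zero],
        fun _ _ => Submodule.mem_top⟩
    | succ k ih =>
      obtain ⟨q, hq, r, hr, hqr, hqK⟩ := ih
      have hdq : delta b b q = 0 := by rw [hqr, map_sub, hde, delta_delta, sub_zero]
      -- Since `q` is closed, `δ (s q) = (δ s) q`. Therefore `u q = q - δ (s q) = e - δ (r + s q)`,
      -- which dictates the new primitive.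
      have hd : delta b b (comp b b b s q) = comp b b b (delta b b s) q := by
        rw [delta_comp, hdq, map_zero, add_zero]
      have hu : e - delta b b s ∈ degree b b 0 :=
        Submodule.sub_mem _ he (h11 ▸ delta_mem_degree hs)
      refine ⟨comp b b b (e - delta b b s) q, add_zero (0 : ZMod 2) ▸ comp_mem_degree hu hq,
        r + comp b b b s q,
        Submodule.add_mem _ hr (add_zero (1 : ZMod 2) ▸ comp_mem_degree hs hq), ?_, fun x hx => ?_⟩
      · rw [map_add, hd, map_sub, LinearMap.sub_apply, hel]
        nth_rw 1 [hqr]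
        abel
      · rw [comp_apply]
        refine comp_mem_rankGE_succ ?_ (hqK x hx)
        rw [Form.sub_apply, hex]
        exact hsK x hx
  -- One more factor than the dimension of the space of antiholomorphic covectors forces `q` to
  -- vanish off `K`.
  obtain ⟨q, hq, r, hr, hqr, hqK⟩ := key (Module.finrank ℂ (V →L⋆[ℂ] ℂ) + 1)
  have hqc : closure {x | q.1 x ≠ 0} ⊆ K := closure_minimal (fun x hx => by
    by_contra h
    exact hx (eq_zero_of_mem_rankGE (Nat.lt_succ_self _) (hqK x h))) hK.isClosed
  refine ⟨q, hK.of_isClosed_subset isClosed_closure hqc, hq, r, hr, fun a f => ⟨?_, ?_⟩⟩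
  · have hdq : delta b b q = 0 := by rw [hqr, map_sub, hde, delta_delta, sub_zero]
    rw [delta_comp, hdq, mem_degree.1 hq, uzpow_zero, one_smul, map_zero, LinearMap.zero_apply,
      zero_add]
  -- As `r` is odd, the term `r (δ f)` in the Leibniz rule has a minus sign and cancels the second
  -- summand, leaving `(δ r) f = (e - q) f`.
  · rw [delta_comp, mem_degree.1 hr, uzpow_one, Units.neg_smul, one_smul, map_neg,
      LinearMap.neg_apply, neg_add_cancel_right, hqr, map_sub, LinearMap.sub_apply, hel]
    abel

theorem comp_mem_compactMor_right {a b c : HolFactorization.{u, v, w} W} (α : Mor b c)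
    {β : Mor a b} (hβ : β ∈ compactMor a b) : comp a b c α β ∈ compactMor a c :=
  compactMor_of_subset hβ fun x hx => by
    rw [comp_apply, hx]
    simp [FormFiber.comp]

end HolFactorization

open HolFactorization

/-- Left composition with `q` and with `r` supplies the projection and the homotopy. The form `r`
need not have compact support, but `r f` vanishes wherever `f` does, so the same operator restricts
to compactly supported forms and serves both homotopy identities. -/
theorem isHomotopyEquivalence_inclusion [T2Space X] [SigmaCompactSpace X]
    (hW : IsCompact (critSet W)) (a b : HolFactorization.{u, v, w} W) :
    (inclusion.{u, v, w} W).IsHomotopyEquivalence a b := by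
  obtain ⟨q, hqc, hq, r, hr, hqr⟩ := exists_compact_homotopy hW b
  refine ⟨(HolFactorization.comp a b b q).codRestrict (compactMor a b)
      fun f => comp_mem_compactMor hqc f, HolFactorization.comp a b b r,
    (HolFactorization.comp a b b r).restrict fun f hf => comp_mem_compactMor_right r hf,
    fun i f hf => ?_, fun i f hf => ?_, fun i f hf => ?_, fun f => Subtype.ext (hqr a f).1,
    fun f => (hqr a f).2, fun f => Subtype.ext (hqr a f.1).2, fun _ => rfl⟩
  · have h := comp_mem_degree hq hf
    rwa [zero_add] at h
  · have h := comp_mem_degree hr hf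
    rwa [add_comm] at h
  · have h := comp_mem_degree hr (show f.1 ∈ degree a b i from hf)
    rwa [add_comm] at h

end Homotopy

/-! ### Formal consequences for dg-categories -/

section DG

universe r o h o' h'

variable {R : Type r} [CommRing R] {𝒮 : DGCategory.{r, o, h} R} {𝒯 : DGCategory.{r, o', h'} R}

theorem DGFunctor.IsHomotopyEquivalence.bijective_mapCoh {Φ : DGFunctor 𝒮 𝒯} {a b : 𝒮.Obj}
    (H : Φ.IsHomotopyEquivalence a b) : Function.Bijective (Φ.mapCoh a b) := by
  obtain ⟨p, h, h', -, -, -, hp, hh, hh', -⟩ := H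
  refine ⟨(injective_iff_map_eq_zero _).2 fun x => ?_, fun x => ?_⟩
  · obtain ⟨⟨f, hf⟩, rfl⟩ := Submodule.mkQ_surjective _ x
    intro hx
    obtain ⟨g, hg⟩ : ∃ g, 𝒯.d _ _ g = Φ.map a b f := (Submodule.Quotient.mk_eq_zero _).1 hx
    -- If the image of `f` is `d g`, then applying `p` gives `p (d g) = d (p g)`, while the homotopy
    -- gives `f - d (p g) = d (h' f)`. Hence `p g + h' f` is a primitive of `f`.
    refine (Submodule.Quotient.mk_eq_zero _).2 ⟨p g + h' f, ?_⟩
    have h1 := hh' f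
    rw [LinearMap.mem_ker.1 hf, map_zero, add_zero, ← hg, hp] at h1
    rw [map_add, ← h1]
    exact add_sub_cancel _ _
  · obtain ⟨⟨f, hf⟩, rfl⟩ := Submodule.mkQ_surjective _ x
    have hf' := LinearMap.mem_ker.1 hf
    refine ⟨Submodule.Quotient.mk ⟨p f, by rw [LinearMap.mem_ker, ← hp, hf', map_zero]⟩, ?_⟩
    -- The class of `f` is hit by that of `p f`. The minus sign appears because the quotient
    -- compares the image of `p f` minus `f`, whereas the homotopy computes the opposite difference.
    refine (Submodule.Quotient.eq _).2 ⟨-h f, ?_⟩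
    have h1 := hh f
    rw [hf', map_zero, add_zero] at h1
    rw [map_neg, ← h1]
    exact neg_sub _ _

/-- A strict identity is its own inverse and acts as the identity already before passing to
cohomology, so both primitives are zero. Reflexivity suffices for essential surjectivity of a
functor that is the identity on objects. -/
theorem DGCategory.IsUnital.cohIso_refl (h : 𝒯.IsUnital) (a : 𝒯.Obj) : 𝒯.CohIso a a := by
  obtain ⟨e, he, hd, hl, hr⟩ := h a
  have hid : 𝒯.IsCohId a (𝒯.comp a a a e e) := by
    rw [hl]
    exact ⟨fun b f _ => ⟨0, by rw [hl, sub_self, map_zero]⟩,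
      fun b f _ => ⟨0, by rw [hr, sub_self, map_zero]⟩⟩
  exact ⟨e, he, e, he, hd, hd, hid, hid⟩

end DG
end LG
end

/-! ### The quasi-equivalence of the compactly supported and the full category -/

theorem mainTheorem5 {V : Type u} [NormedAddCommGroup V] [NormedSpace ℂ V] [FiniteDimensional ℂ V]
    {X : Type v} [TopologicalSpace X] [ChartedSpace V X] [IsManifold 𝓘(ℂ, V) ω X]
    [T2Space X] [ParacompactSpace X] [ConnectedSpace X]
    (W : LG.HolFun V X) (hW : IsCompact (LG.critSet W)) :
    (LG.inclusion.{u, v, w} W).IsQuasiEquivalence ∧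
      ∀ a b : (LG.DFc.{u, v, w} W).Obj, (LG.inclusion.{u, v, w} W).IsHomotopyEquivalence a b := by
  have : ProperSpace V := FiniteDimensional.proper ℂ V
  have : LocallyCompactSpace X := ChartedSpace.locallyCompactSpace V X
  -- Partitions of unity are used on `σ`-compact manifolds; connectedness and paracompactness
  -- provide this.
  have : SigmaCompactSpace X := LG.sigmaCompactSpace_of_connected
  have h := LG.isHomotopyEquivalence_inclusion.{u, v, w} hW
  exact ⟨⟨fun a b => (h a b).bijective_mapCoh, fun t => ⟨t, (LG.isUnital_DF W).cohIso_refl t⟩⟩, h⟩
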